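/- **Setting.** For $m,n\ge 0$ let $\operatorname{Cob}^m_n$ be Bar-Natan's category. Its objects are formal shifts $q^s a$ ($s\in\mathbb Z$) of properly embedded $1$-manifolds (diagrams) $a$ in $[0,1]^2$ with $m$ fixed boundary points on the top edge and $n$ on the bottom edge, closed components being allowed. Its morphisms are $\mathbb Z[\alpha]$-linear combinations of dotted cobordisms in $[0,1]^2\times[0,1]$, modulo isotopy rel boundary and the local relations: a sphere with $0,1,2,3$ dots equals $0,1,0,\alpha$ respectively; an undotted neck equals the sum of the two ways of cutting it and placing one dot on one of the two resulting discs; a sheet with a handle is twice the sheet with a dot. It is graded by $\deg\alpha=4$ and $\deg(S\colon q^s a\to q^t b)=t-s-\chi(S)+\tfrac{m+n}{2}+2\cdot\#\{\text{dots}\}$ for a cobordism $S$, where $\chi(S)$ is the Euler characteristic of the underlying surface. Let $\mathrm{BN}^m_n$ be the closure of $\operatorname{Cob}^m_n$ under formal finite direct sums, with matrices as morphisms, and let $(\mathrm{BN}^m_n)^{\oplus}$ be its closure under formal countable direct sums, with matrices with finite columns as morphisms. Vertical stacking ($a\otimes b$ is $a$ on top of $b$) gives a bilinear functor $\otimes\colon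 \operatorname{Cob}^k_n\times\operatorname{Cob}^n_m\to\operatorname{Cob}^k_m$ (on morphisms of $q$-degree zero), which extends to direct sums. Let $\operatorname{Ch}(\mathcal A)$ denote the possibly unbounded cochain complexes over $\mathcal A$, with differentials of homological degree $+1$ and $q$-degree $0$, and write $C\simeq 0$ if $C$ is contractible, i.e. if $\mathrm{id}_C=dh+hd$ for some $h$ of homological degree $-1$ and $q$-degree $0$. For complexes $N$ and $Q$ over $(\mathrm{BN}^k_n)^\oplus$ and $(\mathrm{BN}^n_m)^\oplus$ (in particular over $\mathrm{BN}^k_n$ and $\mathrm{BN}^n_m$), $N\otimes Q\in\operatorname{Ch}((\mathrm{BN}^k_m)^\oplus)$ is the direct sum total complex $(N\otimes Q)^l=\bigoplus_{i+j=l}N^i\otimes Q^j$ with differential $d_N\otimes 1+(-1)^i\,1\otimes d_Q$ on $N^i\otimes Q^j$. For $0\le i\le n-2$ let $a_i\in\operatorname{Cob}^{n-2}_n$ be the turnback which consists of one arc that joins the two adjacent bottom points having $i$ points to their left, and of $n-2$ strands that run from top to bottom. A complex $Q\in\operatorname{Ch}(\mathrm{BN}^n_m)$ *kills turnbacks from above*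 if $a_i\otimes Q\simeq 0$ for all $0\le i\le n-2$. The *through-degree* $\tau(c)$ of a diagram $c$ is the least $l$ such that $c$ is isotopic to $a\otimes b$ for some diagrams $a,b$ with $l$ points between $a$ and $b$; the through-degree $\tau(N)$ of a complex $N$ is the supremum of $\tau(c)$ over all direct summands $c$ of all chain objects $N^i$ (and $-\infty$ if there are none). A complex is bounded below (above) if its chain objects are zero in all sufficiently negative (positive) homological degrees. **Lemma (Turnback killing).** Let $k,n,m\ge 0$, let $Q\in\operatorname{Ch}(\mathrm{BN}^n_m)$ kill turnbacks from above, and let $N\in\operatorname{Ch}(\mathrm{BN}^k_n)$ satisfy $\tau(N)<n$. If $Q$ is bounded below or $N$ is bounded above, then $N\otimes Q\simeq 0$. The same is true for every $N\in\operatorname{Ch}((\mathrm{BN}^k_n)^\oplus)$ with $\tau(N)<n$. -/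

import Mathlib

open CategoryTheory CategoryTheory.Limits

namespace BarNatan

/-! ## Planar diagrams

A properly embedded 1-submanifold of the square, with `m` boundary points on the top edge and `n` on
the bottom edge, is put in Morse position with respect to the height function and recorded as the
word of its local maxima and minima, read from top to bottom.  Every such submanifold is isotopic
(rel boundary) to one of these; closed components are allowed. -/

/-- Diagrams with `m` points on the top and `n` points on the bottom.
* `nil n` is `n` vertical strands (the identity diagram `1_n`);
* `cap i w` is the diagram `w` with an arc put on top of it which joins the top points
  number `i` and `i + 1` of `w`;
* `cup i w` is the diagram `w` with an arc put on top of it which creates two new adjacent top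
  points, with `i` strands on the left of them.
Positions are counted from `0`. -/
inductive Diag : ℕ → ℕ → Type
  | nil (n : ℕ) : Diag n n
  | cap {m n : ℕ} (i : Fin (m + 1)) (w : Diag (m + 2) n) : Diag m n
  | cup {m n : ℕ} (i : Fin (m + 1)) (w : Diag m n) : Diag (m + 2) n

/-- Vertical stacking: `a.stack b` is `a` on top of `b`. -/
def Diag.stack {k n : ℕ} : {m : ℕ} → Diag m k → Diag k n → Diag m n
  | _, .nil _, b => b
  | _, .cap i w, b => .cap i (w.stack b)
  | _, .cup i w, b => .cup i (w.stack b)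

/-- The elementary planar isotopies of diagrams in Morse position, performed at the top of a
diagram: cancelling a maximum against a neighbouring minimum (`zigzag`), and exchanging the heights
of two critical points which are far apart. -/
inductive Slide : {m n : ℕ} → Diag m n → Diag m n → Type
  | zigzag {m n : ℕ} (i j : Fin (m + 1)) (h : j.val = i.val + 1 ∨ i.val = j.val + 1)
      (w : Diag m n) : Slide (.cap j (.cup i w)) w
  | capCap {m n : ℕ} (i j : Fin (m + 1)) (h : i ≤ j) (w : Diag (m + 4) n) :
      Slide (.cap i (.cap (j.addNat 2) w)) (.cap j (.cap (i.castAdd 2) w))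
  | cupCup {m n : ℕ} (i j : Fin (m + 1)) (h : i ≤ j) (w : Diag m n) :
      Slide (.cup (j.addNat 2) (.cup i w)) (.cup (i.castAdd 2) (.cup j w))
  | capCup {m n : ℕ} (i j : Fin (m + 1)) (h : i ≤ j) (w : Diag (m + 2) n) :
      Slide (.cap (i.castAdd 2) (.cup (j.addNat 2) w)) (.cup j (.cap i w))
  | cupCap {m n : ℕ} (i j : Fin (m + 1)) (h : i ≤ j) (w : Diag (m + 2) n) :
      Slide (.cap (j.addNat 2) (.cup (i.castAdd 2) w)) (.cup i (.cap j w))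

/-- Planar isotopy (rel boundary) of diagrams. -/
inductive Isotopic : {m n : ℕ} → Diag m n → Diag m n → Prop
  | slide {m n : ℕ} {a b : Diag m n} (s : Slide a b) : Isotopic a b
  | cap {m n : ℕ} (i : Fin (m + 1)) {a b : Diag (m + 2) n} (h : Isotopic a b) :
      Isotopic (.cap i a) (.cap i b)
  | cup {m n : ℕ} (i : Fin (m + 1)) {a b : Diag m n} (h : Isotopic a b) :
      Isotopic (.cup i a) (.cup i b)
  | refl {m n : ℕ} (a : Diag m n) : Isotopic a a
  | symm {m n : ℕ} {a b : Diag m n} (h : Isotopic a b) : Isotopic b a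
  | trans {m n : ℕ} {a b c : Diag m n} (h : Isotopic a b) (h' : Isotopic b c) : Isotopic a c

/-- The through-degree of a diagram `c`: the least `k` such that `c` is, up to isotopy, `a ⊗ b` with
`k` points between `a` and `b`. -/
noncomputable def Diag.throughDegree {m n : ℕ} (c : Diag m n) : ℕ :=
  sInf {k | ∃ (a : Diag m k) (b : Diag k n), Isotopic c (a.stack b)}

/-- The turnbacks `a_i`, `0 ≤ i ≤ n - 2`: one arc which joins the bottom points number `i` and
`i + 1`, and `n - 2` vertical strands. -/
inductive IsTurnback : {k n : ℕ} → Diag k n → Prop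
  | mk {k : ℕ} (i : Fin (k + 1)) : IsTurnback (.cap i (.nil (k + 2)))

/-! ### The strands of a diagram -/

/-- `Diag.Pt w` has one element for every bottom point and one for every minimum (`cup`) of `w`.
The components of the 1-manifold `w` are the classes of `Diag.Pt w` under the equivalence
relation generated by `Diag.Adj`. -/
def Diag.Pt : {m n : ℕ} → Diag m n → Type
  | _, _, .nil n => Fin n
  | _, _, .cap _ w => w.Pt
  | _, _, .cup _ w => Option w.Pt

/-- Removing the adjacent points `i` and `i + 1`: the order embedding that misses them. -/
def skip {m : ℕ} (i : Fin (m + 1)) (j : Fin m) : Fin (m + 2) :=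
  if j.val < i.val then j.castAdd 2 else j.addNat 2

/-- The strand that ends at the `j`-th top point. -/
def Diag.top : {m n : ℕ} → (w : Diag m n) → Fin m → w.Pt
  | _, _, .nil _, j => j
  | _, _, .cap i w, j => w.top (skip i j)
  | _, _, .cup i w, j =>
    if h : j.val < i.val then some (w.top ⟨j.val, by omega⟩)
    else if h' : i.val + 2 ≤ j.val then some (w.top ⟨j.val - 2, by omega⟩)
    else none

/-- Two strands are adjacent if they are joined by a maximum (`cap`). -/
def Diag.Adj : {m n : ℕ} → (w : Diag m n) → w.Pt → w.Pt → Prop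
  | _, _, .nil _, _, _ => False
  | _, _, .cap i w, p, q => w.Adj p q ∨ (p = w.top i.castSucc ∧ q = w.top i.succ)
  | _, _, .cup _ w, p, q => ∃ p' q', p = some p' ∧ q = some q' ∧ w.Adj p' q'

/-! ## Dotted cobordisms

A cobordism in the cube is given by a movie: a sequence of planar isotopies of diagrams, Morse
moves (birth and death of a circle, saddles) and dots. -/

/-- The elementary cobordisms.  A move can take place at any height of a diagram. -/
inductive Step : {m n : ℕ} → Diag m n → Diag m n → Type
  | cap {m n : ℕ} (i : Fin (m + 1)) {a b : Diag (m + 2) n} (s : Step a b) :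
      Step (.cap i a) (.cap i b)
  | cup {m n : ℕ} (i : Fin (m + 1)) {a b : Diag m n} (s : Step a b) :
      Step (.cup i a) (.cup i b)
  | slide {m n : ℕ} {a b : Diag m n} (s : Slide a b) : Step a b
  | unslide {m n : ℕ} {a b : Diag m n} (s : Slide a b) : Step b a
  | dot {m n : ℕ} (j : Fin m) (w : Diag m n) : Step w w
  | birth {m n : ℕ} (i : Fin (m + 1)) (w : Diag m n) : Step w (.cap i (.cup i w))
  | death {m n : ℕ} (i : Fin (m + 1)) (w : Diag m n) : Step (.cap i (.cup i w)) w
  | saddle {m n : ℕ} (i : Fin (m + 1)) (w : Diag (m + 2) n) : Step (.cup i (.cap i w)) w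
  | cosaddle {m n : ℕ} (i : Fin (m + 1)) (w : Diag (m + 2) n) : Step w (.cup i (.cap i w))

/-- Movies: composites of elementary cobordisms. -/
inductive Movie {m n : ℕ} (a : Diag m n) : Diag m n → Type
  | nil : Movie a a
  | cons {b c : Diag m n} (p : Movie a b) (s : Step b c) : Movie a c

/-- Composition of movies (stacking of cobordisms). -/
def Movie.comp {m n : ℕ} {a b : Diag m n} (p : Movie a b) :
    {c : Diag m n} → Movie b c → Movie a c
  | _, .nil => p
  | _, .cons q s => .cons (p.comp q) s

/-- The movie with one step. -/
def Step.toMovie {m n : ℕ} {a b : Diag m n} (s : Step a b) : Movie a b := .cons .nil s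

/-- The elementary cobordism `s` below the identity cobordism of `c`. -/
def Step.stackL {k n : ℕ} {a b : Diag k n} : {m : ℕ} → (c : Diag m k) → Step a b →
    Step (c.stack a) (c.stack b)
  | _, .nil _, s => s
  | _, .cap i c, s => .cap i (s.stackL c)
  | _, .cup i c, s => .cup i (s.stackL c)

/-- The elementary isotopy `s` above the diagram `c`. -/
def Slide.stackR {k n : ℕ} (c : Diag k n) : {m : ℕ} → {a b : Diag m k} → Slide a b →
    Slide (a.stack c) (b.stack c)
  | _, _, _, .zigzag i j h w => .zigzag i j h (w.stack c)
  | _, _, _, .capCap i j h w => .capCap i j h (w.stack c)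
  | _, _, _, .cupCup i j h w => .cupCup i j h (w.stack c)
  | _, _, _, .capCup i j h w => .capCup i j h (w.stack c)
  | _, _, _, .cupCap i j h w => .cupCap i j h (w.stack c)

/-- The elementary cobordism `s` above the identity cobordism of `c`. -/
def Step.stackR {k n : ℕ} (c : Diag k n) : {m : ℕ} → {a b : Diag m k} → Step a b →
    Step (a.stack c) (b.stack c)
  | _, _, _, .cap i s => .cap i (s.stackR c)
  | _, _, _, .cup i s => .cup i (s.stackR c)
  | _, _, _, .slide s => .slide (s.stackR c)
  | _, _, _, .unslide s => .unslide (s.stackR c)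
  | _, _, _, .dot j w => .dot j (w.stack c)
  | _, _, _, .birth i w => .birth i (w.stack c)
  | _, _, _, .death i w => .death i (w.stack c)
  | _, _, _, .saddle i w => .saddle i (w.stack c)
  | _, _, _, .cosaddle i w => .cosaddle i (w.stack c)

/-- The cobordism `p` below the identity cobordism of `c`. -/
def Movie.stackL {m k n : ℕ} (c : Diag m k) {a : Diag k n} :
    {b : Diag k n} → Movie a b → Movie (c.stack a) (c.stack b)
  | _, .nil => .nil
  | _, .cons p s => .cons (p.stackL c) (s.stackL c)

/-- The cobordism `p` above the identity cobordism of `c`. -/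
def Movie.stackR {m k n : ℕ} (c : Diag k n) {a : Diag m k} :
    {b : Diag m k} → Movie a b → Movie (a.stack c) (b.stack c)
  | _, .nil => .nil
  | _, .cons p s => .cons (p.stackR c) (s.stackR c)

/-! ### The surface underlying a movie -/

/-- `s.Corr p q` holds if the strand `p` before and the strand `q` after an elementary isotopy
sweep out the same sheet. -/
def Slide.Corr : {m n : ℕ} → {a b : Diag m n} → Slide a b → a.Pt → b.Pt → Prop
  | _, _, _, _, .zigzag _ _ _ _, p, q => p = some q
  | _, _, _, _, .capCap _ _ _ _, p, q => p = q
  | _, _, _, _, .cupCup _ _ _ w, p, q =>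
      (p = none ∧ q = some none) ∨ (p = some none ∧ q = none) ∨
        ∃ r : w.Pt, p = some (some r) ∧ q = some (some r)
  | _, _, _, _, .capCup _ _ _ _, p, q => p = q
  | _, _, _, _, .cupCap _ _ _ _, p, q => p = q

/-- `s.Corr p q` holds if the strand `p` before and the strand `q` after the move `s` lie on the
same sheet of the elementary cobordism `s`. -/
def Step.Corr : {m n : ℕ} → {a b : Diag m n} → Step a b → a.Pt → b.Pt → Prop
  | _, _, _, _, .cap _ s, p, q => s.Corr p q
  | _, _, _, _, .cup _ s, p, q =>
      (p = none ∧ q = none) ∨ ∃ p' q', p = some p' ∧ q = some q' ∧ s.Corr p' q'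
  | _, _, _, _, .slide s, p, q => s.Corr p q
  | _, _, _, _, .unslide s, p, q => s.Corr q p
  | _, _, _, _, .dot _ _, p, q => p = q
  | _, _, _, _, .birth _ _, p, q => q = some p
  | _, _, _, _, .death _ _, p, q => p = some q
  | _, _, _, _, .saddle i w, p, q => p = some q ∨ (p = none ∧ q = w.top i.castSucc)
  | _, _, _, _, .cosaddle i w, p, q => q = some p ∨ (q = none ∧ p = w.top i.castSucc)

/-- The handles of an elementary cobordism, each with a strand of the component which contains it
and with its contribution to the Euler characteristic: `1` for the disc of a birth or a death,
`-1` for a saddle. -/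
def Step.handles : {m n : ℕ} → {a b : Diag m n} → Step a b → List ((a.Pt ⊕ b.Pt) × ℤ)
  | _, _, _, _, .cap _ s => s.handles
  | _, _, _, _, .cup _ s => s.handles.map (Prod.map (Sum.map some some) id)
  | _, _, _, _, .slide _ => []
  | _, _, _, _, .unslide _ => []
  | _, _, _, _, .dot _ _ => []
  | _, _, _, _, .birth _ _ => [(Sum.inr none, 1)]
  | _, _, _, _, .death _ _ => [(Sum.inl none, 1)]
  | _, _, _, _, .saddle i w => [(Sum.inr (w.top i.castSucc), -1)]
  | _, _, _, _, .cosaddle i w => [(Sum.inl (w.top i.castSucc), -1)]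

/-- The strands on which an elementary cobordism carries a dot. -/
def Step.dots : {m n : ℕ} → {a b : Diag m n} → Step a b → List a.Pt
  | _, _, _, _, .cap _ s => s.dots
  | _, _, _, _, .cup _ s => s.dots.map some
  | _, _, _, _, .slide _ => []
  | _, _, _, _, .unslide _ => []
  | _, _, _, _, .dot j w => [w.top j]
  | _, _, _, _, .birth _ _ => []
  | _, _, _, _, .death _ _ => []
  | _, _, _, _, .saddle _ _ => []
  | _, _, _, _, .cosaddle _ _ => []

/-- The strands of all frames of a movie. -/
def Movie.Pt {m n : ℕ} {a : Diag m n} : {b : Diag m n} → Movie a b → Type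
  | _, .nil => a.Pt
  | c, .cons p _ => p.Pt ⊕ c.Pt

/-- The strands of the first frame. -/
def Movie.inn {m n : ℕ} {a : Diag m n} : {b : Diag m n} → (p : Movie a b) → a.Pt → p.Pt
  | _, .nil, x => x
  | _, .cons p _, x => Sum.inl (p.inn x)

/-- The strands of the last frame. -/
def Movie.out {m n : ℕ} {a : Diag m n} : {b : Diag m n} → (p : Movie a b) → b.Pt → p.Pt
  | _, .nil, x => x
  | _, .cons _ _, x => Sum.inr x

/-- Two strands of a movie are adjacent if they are adjacent in the same frame or if they
lie on the same sheet between two consecutive frames. -/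
def Movie.Adj {m n : ℕ} {a : Diag m n} : {b : Diag m n} → (p : Movie a b) → p.Pt → p.Pt → Prop
  | _, .nil => a.Adj
  | c, .cons p s => fun (x y : p.Pt ⊕ c.Pt) =>
    match x, y with
    | Sum.inl x, Sum.inl y => p.Adj x y
    | Sum.inr x, Sum.inr y => c.Adj x y
    | Sum.inl x, Sum.inr y => ∃ z, x = p.out z ∧ s.Corr z y
    | Sum.inr _, Sum.inl _ => False

/-- The connected components of the surface of a movie. -/
def Movie.Comp {m n : ℕ} {a b : Diag m n} (p : Movie a b) : Type := Quot p.Adj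

/-- The handles of a movie, with their contributions to the Euler characteristic. -/
def Movie.handles {m n : ℕ} {a : Diag m n} : {b : Diag m n} → (p : Movie a b) → List (p.Pt × ℤ)
  | _, .nil => []
  | _, .cons p s => p.handles.map (Prod.map Sum.inl id) ++
      s.handles.map (Prod.map (Sum.map p.out id) id)

/-- The dots of a movie. -/
def Movie.dots {m n : ℕ} {a : Diag m n} : {b : Diag m n} → (p : Movie a b) → List p.Pt
  | _, .nil => []
  | _, .cons p s => p.dots.map Sum.inl ++ s.dots.map (fun x => Sum.inl (p.out x))

open scoped Classical in
/-- The relative Euler characteristic `χ(C) - χ(C ∩ a)` of a component `C` of the surface of a movie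
which starts with the diagram `a` (here `χ(C ∩ a)` is the number of arcs of `a` on `C`). -/
noncomputable def Movie.euler {m n : ℕ} {a b : Diag m n} (p : Movie a b) (C : p.Comp) : ℤ :=
  (p.handles.map fun h => if Quot.mk p.Adj h.1 = C then h.2 else 0).sum

open scoped Classical in
/-- The number of dots on a component of the surface of a movie. -/
noncomputable def Movie.dotCount {m n : ℕ} {a b : Diag m n} (p : Movie a b) (C : p.Comp) : ℕ :=
  (p.dots.map fun x => if Quot.mk p.Adj x = C then 1 else 0).sum

/-- Two movies with the same first and last diagram have the same surface: there is a homeomorphism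
rel boundary between the underlying dotted surfaces.  By the classification of (orientable)
surfaces, this says that the components of the surfaces correspond to each other, compatibly with
their boundaries, Euler characteristics and numbers of dots.  (Modulo the local relations below,
which contain neck-cutting, homeomorphic cobordisms agree if and only if isotopic ones do: both are
determined by the dotted discs into which they are cut.) -/
def SameSurface {m n : ℕ} {a b : Diag m n} (p q : Movie a b) : Prop :=
  ∃ e : p.Comp ≃ q.Comp,
    (∀ x, e (Quot.mk _ (p.inn x)) = Quot.mk _ (q.inn x)) ∧
    (∀ x, e (Quot.mk _ (p.out x)) = Quot.mk _ (q.out x)) ∧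
    ∀ C, p.euler C = q.euler (e C) ∧ p.dotCount C = q.dotCount (e C)

/-- The degree `-χ(S) + (m + n) / 2` of a cobordism, where each dot counts for two.  For a cobordism
`S` that starts with the diagram `a`, `(m + n) / 2` is the Euler characteristic of `a`. -/
def Movie.deg {m n : ℕ} {a b : Diag m n} (p : Movie a b) : ℤ :=
  2 * p.dots.length - (p.handles.map Prod.snd).sum


/-! ## The category `Cob^m_n` -/

open scoped Polynomial

theorem Movie.nil_comp {m n : ℕ} {a b : Diag m n} (p : Movie a b) : Movie.nil.comp p = p := by
  induction p with
  | nil => rfl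
  | cons p s ih => exact congrArg (fun q => Movie.cons q s) ih

theorem Movie.comp_assoc {m n : ℕ} {a b c d : Diag m n} (p : Movie a b) (q : Movie b c)
    (r : Movie c d) : (p.comp q).comp r = p.comp (q.comp r) := by
  induction r with
  | nil => rfl
  | cons r s ih => exact congrArg (fun q => Movie.cons q s) ih

theorem Movie.stackL_comp {m k n : ℕ} (c : Diag m k) {a b d : Diag k n} (p : Movie a b)
    (q : Movie b d) : (p.comp q).stackL c = (p.stackL c).comp (q.stackL c) := by
  induction q with
  | nil => rfl
  | cons q s ih => exact congrArg (fun q => Movie.cons q _) ih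

theorem Movie.stackR_comp {m k n : ℕ} (c : Diag k n) {a b d : Diag m k} (p : Movie a b)
    (q : Movie b d) : (p.comp q).stackR c = (p.stackR c).comp (q.stackR c) := by
  induction q with
  | nil => rfl
  | cons q s ih => exact congrArg (fun q => Movie.cons q _) ih

/-- The category of diagrams and movies. -/
instance {m n : ℕ} : Category (Diag m n) where
  Hom a b := Movie a b
  id _ := Movie.nil
  comp p q := p.comp q
  id_comp p := p.nil_comp
  comp_id _ := rfl
  assoc p q r := p.comp_assoc q r

/-- `b ↦ c ⊗ b` on movies. -/
@[simps]
def stackLMovie {m k : ℕ} (n : ℕ) (c : Diag m k) : Diag k n ⥤ Diag m n where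
  obj b := c.stack b
  map p := Movie.stackL c p
  map_id _ := rfl
  map_comp p q := Movie.stackL_comp c p q

/-- `b ↦ b ⊗ c` on movies. -/
@[simps]
def stackRMovie {k n : ℕ} (m : ℕ) (c : Diag k n) : Diag m k ⥤ Diag m n where
  obj b := b.stack c
  map p := Movie.stackR c p
  map_id _ := rfl
  map_comp p q := Movie.stackR_comp c p q

/-- Diagrams, with `ℤ[α]`-linear combinations of movies as morphisms; `α` is the variable
`Polynomial.X`. -/
abbrev PreCob (m n : ℕ) := Free ℤ[X] (Diag m n)

/-- A movie as a morphism of `PreCob m n`. -/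
noncomputable abbrev Movie.toPre {m n : ℕ} {a b : Diag m n} (p : Movie a b) :
    (Free.embedding ℤ[X] (Diag m n)).obj a ⟶ (Free.embedding ℤ[X] (Diag m n)).obj b :=
  (Free.embedding ℤ[X] (Diag m n)).map p

/-- `b ↦ c ⊗ b` on linear combinations of movies. -/
noncomputable abbrev stackLPre {m k : ℕ} (n : ℕ) (c : Diag m k) : PreCob k n ⥤ PreCob m n :=
  Free.lift ℤ[X] (stackLMovie n c ⋙ Free.embedding ℤ[X] (Diag m n))

/-- `b ↦ b ⊗ c` on linear combinations of movies. -/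
noncomputable abbrev stackRPre {k n : ℕ} (m : ℕ) (c : Diag k n) : PreCob m k ⥤ PreCob m n :=
  Free.lift ℤ[X] (stackRMovie m c ⋙ Free.embedding ℤ[X] (Diag m n))

/-- A circle is born next to `w`. -/
abbrev birthOf {m n : ℕ} (i : Fin (m + 1)) (w : Diag m n) : Movie w (.cap i (.cup i w)) :=
  (Step.birth i w).toMovie

/-- A circle next to `w` dies. -/
abbrev deathOf {m n : ℕ} (i : Fin (m + 1)) (w : Diag m n) : Movie (.cap i (.cup i w)) w :=
  (Step.death i w).toMovie

/-- The cylinder over `w` and a circle next to it, with a dot on the circle. -/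
abbrev circleDot {m n : ℕ} (i : Fin (m + 1)) (w : Diag m n) :
    Movie (.cap i (.cup i w)) (.cap i (.cup i w)) :=
  (Step.cap i (.dot i.castSucc (.cup i w))).toMovie

/-- The `j`-th top strand of `w`, with a zigzag in it. -/
abbrev zigzagOf {m n : ℕ} (j : Fin m) (w : Diag m n) : Diag m n :=
  .cap j.castSucc (.cup j.succ (.cap j.succ (.cup j.castSucc w)))

/-- The cylinder over `w`, with a dot on the `j`-th top strand, which is drawn with a zigzag. -/
abbrev sheetDot {m n : ℕ} (j : Fin m) (w : Diag m n) : Movie (zigzagOf j w) (zigzagOf j w) :=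
  (Step.dot j (zigzagOf j w)).toMovie

/-- The cylinder over `w`, with a handle on the sheet of the `j`-th top strand (drawn with a
zigzag): a saddle splits a circle off this strand, and a second saddle merges the circle with the
strand again. -/
abbrev sheetHandle {m n : ℕ} (j : Fin m) (w : Diag m n) : Movie (zigzagOf j w) (zigzagOf j w) :=
  (Step.cap j.castSucc (.saddle j.succ (.cup j.castSucc w))).toMovie.comp
    (Step.cap j.castSucc (.cosaddle j.succ (.cup j.castSucc w))).toMovie

/-- The relations between linear combinations of cobordisms: the smallest congruence which is
`ℤ[α]`-linear and compatible with stacking, which identifies homeomorphic cobordisms (in particular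
isotopic ones) and contains the local relations: the evaluations of the sphere with at most three
dots, neck-cutting, and "sheet with a handle = 2 · sheet with a dot". -/
inductive CobRel : {m n : ℕ} → ⦃a b : PreCob m n⦄ → (a ⟶ b) → (a ⟶ b) → Prop
  | refl {m n : ℕ} {a b : PreCob m n} (f : a ⟶ b) : CobRel f f
  | symm {m n : ℕ} {a b : PreCob m n} {f g : a ⟶ b} : CobRel f g → CobRel g f
  | trans {m n : ℕ} {a b : PreCob m n} {f g h : a ⟶ b} : CobRel f g → CobRel g h → CobRel f h
  | add {m n : ℕ} {a b : PreCob m n} {f g f' g' : a ⟶ b} :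
      CobRel f g → CobRel f' g' → CobRel (f + f') (g + g')
  | smul {m n : ℕ} {a b : PreCob m n} {f g : a ⟶ b} (r : ℤ[X]) :
      CobRel f g → CobRel (r • f) (r • g)
  | comp {m n : ℕ} {a b c : PreCob m n} {f g : a ⟶ b} {f' g' : b ⟶ c} :
      CobRel f g → CobRel f' g' → CobRel (f ≫ f') (g ≫ g')
  | stackL {m k n : ℕ} {a b : PreCob k n} {f g : a ⟶ b} (c : Diag m k) :
      CobRel f g → CobRel ((stackLPre n c).map f) ((stackLPre n c).map g)
  | stackR {m k n : ℕ} {a b : PreCob m k} {f g : a ⟶ b} (c : Diag k n) :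
      CobRel f g → CobRel ((stackRPre m c).map f) ((stackRPre m c).map g)
  | surface {m n : ℕ} {a b : Diag m n} (p q : Movie a b) (h : SameSurface p q) :
      CobRel p.toPre q.toPre
  | interchange {m k n : ℕ} {a a' : Diag m k} {b b' : Diag k n} (p : Movie a a')
      (q : Movie b b') :
      CobRel ((p.stackR b).comp (q.stackL a')).toPre ((q.stackL a).comp (p.stackR b')).toPre
  | sphere {m n : ℕ} (i : Fin (m + 1)) (w : Diag m n) :
      CobRel ((birthOf i w).comp (deathOf i w)).toPre 0
  | sphereDot {m n : ℕ} (i : Fin (m + 1)) (w : Diag m n) :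
      CobRel ((birthOf i w).comp ((circleDot i w).comp (deathOf i w))).toPre (𝟙 _)
  | sphereDotDot {m n : ℕ} (i : Fin (m + 1)) (w : Diag m n) :
      CobRel ((birthOf i w).comp ((circleDot i w).comp ((circleDot i w).comp
        (deathOf i w)))).toPre 0
  | sphereDotDotDot {m n : ℕ} (i : Fin (m + 1)) (w : Diag m n) :
      CobRel ((birthOf i w).comp ((circleDot i w).comp ((circleDot i w).comp
        ((circleDot i w).comp (deathOf i w))))).toPre ((Polynomial.X : ℤ[X]) • 𝟙 _)
  | neck {m n : ℕ} (i : Fin (m + 1)) (w : Diag m n) :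
      CobRel (𝟙 ((Free.embedding ℤ[X] (Diag m n)).obj (.cap i (.cup i w))))
        (((deathOf i w).comp ((birthOf i w).comp (circleDot i w))).toPre +
          ((circleDot i w).comp ((deathOf i w).comp (birthOf i w))).toPre)
  | handle {m n : ℕ} (j : Fin m) (w : Diag m n) :
      CobRel (sheetHandle j w).toPre ((2 : ℤ[X]) • (sheetDot j w).toPre)

/-- `CobRel` as a relation on the morphisms of `PreCob m n`. -/
def cobRel (m n : ℕ) : HomRel (PreCob m n) := fun _ _ f g => CobRel f g

instance (m n : ℕ) : Congruence (cobRel m n) where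
  equivalence := ⟨.refl, .symm, .trans⟩
  comp_left _ _ _ h := .comp (.refl _) h
  comp_right _ h := .comp h (.refl _)

/-- The category `Cob^m_n`, without degree shifts: diagrams, and `ℤ[α]`-linear combinations of dotted
cobordisms modulo isotopy and the local relations. -/
noncomputable abbrev Cob (m n : ℕ) := CategoryTheory.Quotient (cobRel m n)

/-- The class of a linear combination of movies. -/
noncomputable abbrev Cob.cls (m n : ℕ) : PreCob m n ⥤ Cob m n :=
  CategoryTheory.Quotient.functor (cobRel m n)

noncomputable instance (m n : ℕ) : Preadditive (Cob m n) :=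
  Quotient.preadditive (cobRel m n) fun _ _ _ _ _ _ h h' => CobRel.add h h'

instance (m n : ℕ) : (Cob.cls m n).Additive :=
  Quotient.functor_additive (cobRel m n) fun _ _ _ _ _ _ h h' => CobRel.add h h'

noncomputable instance (m n : ℕ) : Linear ℤ[X] (Cob m n) :=
  Quotient.linear ℤ[X] (cobRel m n) fun r _ _ _ _ h => CobRel.smul r h

instance (m n : ℕ) : (Cob.cls m n).Linear ℤ[X] :=
  Quotient.linear_functor ℤ[X] (cobRel m n) fun r _ _ _ _ h => CobRel.smul r h

/-- A diagram as an object of `Cob m n`. -/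
noncomputable abbrev Cob.of {m n : ℕ} (a : Diag m n) : Cob m n :=
  (Cob.cls m n).obj ((Free.embedding ℤ[X] (Diag m n)).obj a)

/-- A movie as a morphism of `Cob m n`. -/
noncomputable abbrev Movie.toCob {m n : ℕ} {a b : Diag m n} (p : Movie a b) :
    Cob.of a ⟶ Cob.of b :=
  (Cob.cls m n).map p.toPre

/-- `c ⊗ -` on `Cob`. -/
noncomputable def Cob.stackLFunctor {m k : ℕ} (n : ℕ) (c : Diag m k) : Cob k n ⥤ Cob m n :=
  CategoryTheory.Quotient.lift (cobRel k n) (stackLPre n c ⋙ Cob.cls m n)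
    fun _ _ _ _ h => CategoryTheory.Quotient.sound _ (CobRel.stackL c h)

/-- `- ⊗ c` on `Cob`. -/
noncomputable def Cob.stackRFunctor {k n : ℕ} (m : ℕ) (c : Diag k n) : Cob m k ⥤ Cob m n :=
  CategoryTheory.Quotient.lift (cobRel m k) (stackRPre m c ⋙ Cob.cls m n)
    fun _ _ _ _ h => CategoryTheory.Quotient.sound _ (CobRel.stackR c h)

/-- `f ↦ 1_c ⊗ f` on the morphisms of `Cob`. -/
noncomputable def Cob.stackL {m k n : ℕ} (c : Diag m k) {a b : Diag k n} :
    (Cob.of a ⟶ Cob.of b) →ₗ[ℤ[X]] (Cob.of (c.stack a) ⟶ Cob.of (c.stack b)) where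
  toFun f := (Cob.stackLFunctor n c).map f
  map_add' f g := by
    obtain ⟨f, rfl⟩ := (Cob.cls k n).map_surjective f
    obtain ⟨g, rfl⟩ := (Cob.cls k n).map_surjective g
    rw [← Functor.map_add]
    exact (stackLPre n c ⋙ Cob.cls m n).map_add
  map_smul' r f := by
    obtain ⟨f, rfl⟩ := (Cob.cls k n).map_surjective f
    rw [← Functor.map_smul]
    exact (stackLPre n c ⋙ Cob.cls m n).map_smul r f

/-- `f ↦ f ⊗ 1_c` on the morphisms of `Cob`. -/
noncomputable def Cob.stackR {m k n : ℕ} (c : Diag k n) {a b : Diag m k} :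
    (Cob.of a ⟶ Cob.of b) →ₗ[ℤ[X]] (Cob.of (a.stack c) ⟶ Cob.of (b.stack c)) where
  toFun f := (Cob.stackRFunctor m c).map f
  map_add' f g := by
    obtain ⟨f, rfl⟩ := (Cob.cls m k).map_surjective f
    obtain ⟨g, rfl⟩ := (Cob.cls m k).map_surjective g
    rw [← Functor.map_add]
    exact (stackRPre m c ⋙ Cob.cls m n).map_add
  map_smul' r f := by
    obtain ⟨f, rfl⟩ := (Cob.cls m k).map_surjective f
    rw [← Functor.map_smul]
    exact (stackRPre m c ⋙ Cob.cls m n).map_smul r f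

theorem Cob.stackL_id {m k n : ℕ} (c : Diag m k) (a : Diag k n) :
    Cob.stackL c (𝟙 (Cob.of a)) = 𝟙 (Cob.of (c.stack a)) :=
  (Cob.stackLFunctor n c).map_id _

theorem Cob.stackR_id {m k n : ℕ} (c : Diag k n) (a : Diag m k) :
    Cob.stackR c (𝟙 (Cob.of a)) = 𝟙 (Cob.of (a.stack c)) :=
  (Cob.stackRFunctor m c).map_id _

theorem Cob.stackL_comp {m k n : ℕ} (c : Diag m k) {a b d : Diag k n} (f : Cob.of a ⟶ Cob.of b)
    (g : Cob.of b ⟶ Cob.of d) : Cob.stackL c (f ≫ g) = Cob.stackL c f ≫ Cob.stackL c g :=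
  (Cob.stackLFunctor n c).map_comp f g

theorem Cob.stackR_comp {m k n : ℕ} (c : Diag k n) {a b d : Diag m k} (f : Cob.of a ⟶ Cob.of b)
    (g : Cob.of b ⟶ Cob.of d) : Cob.stackR c (f ≫ g) = Cob.stackR c f ≫ Cob.stackR c g :=
  (Cob.stackRFunctor m c).map_comp f g

theorem Cob.stackL_toCob {m k n : ℕ} (c : Diag m k) {a b : Diag k n} (p : Movie a b) :
    Cob.stackL c p.toCob = (p.stackL c).toCob := by
  change (Cob.cls m n).map ((stackLPre n c).map p.toPre) = _
  congr 1
  exact (Category.comp_id _).symm.trans (((Free.embeddingLiftIso ℤ[X] (stackLMovie n c ⋙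
    Free.embedding ℤ[X] (Diag m n))).hom.naturality p).trans (Category.id_comp _))

theorem Cob.stackR_toCob {m k n : ℕ} (c : Diag k n) {a b : Diag m k} (p : Movie a b) :
    Cob.stackR c p.toCob = (p.stackR c).toCob := by
  change (Cob.cls m n).map ((stackRPre m c).map p.toPre) = _
  congr 1
  exact (Category.comp_id _).symm.trans (((Free.embeddingLiftIso ℤ[X] (stackRMovie m c ⋙
    Free.embedding ℤ[X] (Diag m n))).hom.naturality p).trans (Category.id_comp _))

theorem Movie.comp_toCob {m n : ℕ} {a b c : Diag m n} (p : Movie a b) (q : Movie b c) :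
    (p.comp q).toCob = p.toCob ≫ q.toCob := by
  change (Cob.cls m n).map ((Free.embedding ℤ[X] (Diag m n)).map ((p : a ⟶ b) ≫ (q : b ⟶ c))) = _
  rw [Functor.map_comp, Functor.map_comp]

theorem Cob.hom_induction {m n : ℕ} {a b : Diag m n} {P : (Cob.of a ⟶ Cob.of b) → Prop}
    (zero : P 0) (add : ∀ f g, P f → P g → P (f + g))
    (movie : ∀ (r : ℤ[X]) (p : Movie a b), P (r • p.toCob)) (f : Cob.of a ⟶ Cob.of b) : P f := by
  obtain ⟨f, rfl⟩ := (Cob.cls m n).map_surjective f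
  induction f using Finsupp.induction_linear with
  | zero => simpa using zero
  | add f g hf hg =>
    have := add _ _ hf hg
    rw [← Functor.map_add] at this
    exact this
  | single p r =>
    have := movie r p
    rw [← Functor.map_smul] at this
    convert this using 2
    change _ = r • Finsupp.single p (1 : ℤ[X])
    rw [Finsupp.smul_single, smul_eq_mul, mul_one]

theorem Cob.interchange {m k n : ℕ} {a a' : Diag m k} (f : Cob.of a ⟶ Cob.of a') {b b' : Diag k n}
    (g : Cob.of b ⟶ Cob.of b') :
    Cob.stackR b f ≫ Cob.stackL a' g = Cob.stackL a g ≫ Cob.stackR b' f := by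
  induction f using Cob.hom_induction with
  | zero => rw [map_zero, map_zero, zero_comp, comp_zero]
  | add f f' hf hf' =>
    rw [map_add, map_add, Preadditive.add_comp, Preadditive.comp_add, hf, hf']
  | movie r p =>
    induction g using Cob.hom_induction with
    | zero => rw [map_zero, map_zero, zero_comp, comp_zero]
    | add f f' hf hf' =>
      rw [map_add, map_add, Preadditive.add_comp, Preadditive.comp_add, hf, hf']
    | movie s q =>
      simp only [map_smul, Linear.smul_comp, Linear.comp_smul, Cob.stackL_toCob,
        Cob.stackR_toCob]
      rw [smul_comm]
      congr 2
      have := CategoryTheory.Quotient.sound (cobRel m n) (CobRel.interchange p q)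
      exact (Movie.comp_toCob _ _).symm.trans (this.trans (Movie.comp_toCob _ _))

/-! ### Degrees -/

/-- The degree of an elementary cobordism. -/
def Step.deg {m n : ℕ} {a b : Diag m n} (s : Step a b) : ℤ :=
  2 * s.dots.length - (s.handles.map Prod.snd).sum

theorem sum_map_snd {A B C : Type} (f : A → C) (g : B → C) (l : List (A × ℤ))
    (l' : List (B × ℤ)) :
    ((l.map (Prod.map f id) ++ l'.map (Prod.map g id)).map Prod.snd).sum =
      (l.map Prod.snd).sum + (l'.map Prod.snd).sum := by
  simp [Function.comp_def]

theorem Movie.deg_cons {m n : ℕ} {a b c : Diag m n} (p : Movie a b) (s : Step b c) :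
    (Movie.cons p s).deg = p.deg + s.deg := by
  have h₁ : (Movie.cons p s).dots.length = p.dots.length + s.dots.length := by
    exact List.length_append.trans
      (congrArg₂ (fun x y => x + y) (List.length_map _) (List.length_map _))
  have h₂ : ((Movie.cons p s).handles.map Prod.snd).sum =
      (p.handles.map Prod.snd).sum + (s.handles.map Prod.snd).sum :=
    sum_map_snd _ _ _ _
  rw [Movie.deg, Movie.deg, Step.deg, h₁, h₂]
  push_cast
  ring

theorem Movie.deg_comp {m n : ℕ} {a b c : Diag m n} (p : Movie a b) (q : Movie b c) :
    (p.comp q).deg = p.deg + q.deg := by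
  induction q with
  | nil => simp [Movie.comp, Movie.deg, Movie.dots, Movie.handles]
  | cons q s ih =>
    change (Movie.cons (p.comp q) s).deg = _
    rw [Movie.deg_cons, ih, Movie.deg_cons, add_assoc]

theorem Step.deg_cap {m n : ℕ} (i : Fin (m + 1)) {a b : Diag (m + 2) n} (s : Step a b) :
    (Step.cap i s).deg = s.deg := rfl

theorem Step.deg_cup {m n : ℕ} (i : Fin (m + 1)) {a b : Diag m n} (s : Step a b) :
    (Step.cup i s).deg = s.deg := by
  have h₁ : (Step.cup i s).dots.length = s.dots.length := List.length_map _
  have h₂ : ((Step.cup i s).handles.map Prod.snd) = s.handles.map Prod.snd :=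
    List.map_map.trans rfl
  rw [Step.deg, Step.deg, h₁, h₂]

theorem Step.deg_stackL {m k n : ℕ} (c : Diag m k) {a b : Diag k n} (s : Step a b) :
    (s.stackL c).deg = s.deg := by
  induction c with
  | nil => rfl
  | cap i c ih => exact ih s
  | cup i c ih => exact (Step.deg_cup i _).trans (ih s)

theorem Step.deg_stackR {m k n : ℕ} (c : Diag k n) {a b : Diag m k} (s : Step a b) :
    (s.stackR c).deg = s.deg := by
  induction s with
  | cap i s ih => exact ih c
  | cup i s ih => exact (Step.deg_cup i _).trans ((ih c).trans (Step.deg_cup i _).symm)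
  | _ => rfl

theorem Movie.deg_stackL {m k n : ℕ} (c : Diag m k) {a b : Diag k n} (p : Movie a b) :
    (p.stackL c).deg = p.deg := by
  induction p with
  | nil => rfl
  | cons p s ih =>
    change (Movie.cons (p.stackL c) (s.stackL c)).deg = _
    rw [Movie.deg_cons, Movie.deg_cons, ih, Step.deg_stackL]

theorem Movie.deg_stackR {m k n : ℕ} (c : Diag k n) {a b : Diag m k} (p : Movie a b) :
    (p.stackR c).deg = p.deg := by
  induction p with
  | nil => rfl
  | cons p s ih =>
    change (Movie.cons (p.stackR c) (s.stackR c)).deg = _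
    rw [Movie.deg_cons, Movie.deg_cons, ih, Step.deg_stackR]

/-- The homogeneous morphisms of degree `d` in `Cob m n` (between unshifted diagrams): the sums of
the `α ^ j • S` with `S` a dotted cobordism and `4 j + deg S = d`. -/
noncomputable def Cob.homogeneous {m n : ℕ} (a b : Diag m n) (d : ℤ) : AddSubgroup (Cob.of a ⟶ Cob.of b) :=
  AddSubgroup.closure {f | ∃ (j : ℕ) (p : Movie a b), 4 * (j : ℤ) + p.deg = d ∧
    f = (Polynomial.X ^ j : ℤ[X]) • p.toCob}

theorem Cob.id_mem {m n : ℕ} (a : Diag m n) : 𝟙 (Cob.of a) ∈ Cob.homogeneous a a 0 := by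
  refine AddSubgroup.subset_closure ⟨0, Movie.nil, by simp [Movie.deg, Movie.dots, Movie.handles],
    ?_⟩
  rw [pow_zero, one_smul]
  exact ((Cob.cls m n).map_id _).symm.trans
    (congrArg _ ((Free.embedding ℤ[X] (Diag m n)).map_id a).symm)

theorem Cob.comp_mem {m n : ℕ} {a b c : Diag m n} {d e : ℤ} {f : Cob.of a ⟶ Cob.of b}
    {g : Cob.of b ⟶ Cob.of c} (hf : f ∈ Cob.homogeneous a b d) (hg : g ∈ Cob.homogeneous b c e) :
    f ≫ g ∈ Cob.homogeneous a c (d + e) := by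
  induction hf using AddSubgroup.closure_induction with
  | zero => rw [zero_comp]; exact zero_mem _
  | add f f' _ _ hf hf' => rw [Preadditive.add_comp]; exact add_mem hf hf'
  | neg f _ hf => rw [Preadditive.neg_comp]; exact neg_mem hf
  | mem f hf =>
    obtain ⟨j, p, hj, rfl⟩ := hf
    induction hg using AddSubgroup.closure_induction with
    | zero => rw [comp_zero]; exact zero_mem _
    | add f f' _ _ hf hf' => rw [Preadditive.comp_add]; exact add_mem hf hf'
    | neg f _ hf => rw [Preadditive.comp_neg]; exact neg_mem hf
    | mem g hg =>
      obtain ⟨l, q, hl, rfl⟩ := hg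
      refine AddSubgroup.subset_closure ⟨j + l, p.comp q, ?_, ?_⟩
      · rw [Movie.deg_comp]; push_cast; linarith
      · rw [Movie.comp_toCob, Linear.smul_comp, Linear.comp_smul, smul_smul, pow_add]

theorem Cob.stackL_mem {m k n : ℕ} (c : Diag m k) {a b : Diag k n} {d : ℤ}
    {f : Cob.of a ⟶ Cob.of b} (hf : f ∈ Cob.homogeneous a b d) :
    Cob.stackL c f ∈ Cob.homogeneous (c.stack a) (c.stack b) d := by
  induction hf using AddSubgroup.closure_induction with
  | zero => rw [map_zero]; exact zero_mem _
  | add f f' _ _ hf hf' => rw [map_add]; exact add_mem hf hf'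
  | neg f _ hf => rw [map_neg]; exact neg_mem hf
  | mem f hf =>
    obtain ⟨j, p, hj, rfl⟩ := hf
    exact AddSubgroup.subset_closure ⟨j, p.stackL c, by rw [Movie.deg_stackL]; exact hj,
      by rw [map_smul, Cob.stackL_toCob]⟩

theorem Cob.stackR_mem {m k n : ℕ} (c : Diag k n) {a b : Diag m k} {d : ℤ}
    {f : Cob.of a ⟶ Cob.of b} (hf : f ∈ Cob.homogeneous a b d) :
    Cob.stackR c f ∈ Cob.homogeneous (a.stack c) (b.stack c) d := by
  induction hf using AddSubgroup.closure_induction with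
  | zero => rw [map_zero]; exact zero_mem _
  | add f f' _ _ hf hf' => rw [map_add]; exact add_mem hf hf'
  | neg f _ hf => rw [map_neg]; exact neg_mem hf
  | mem f hf =>
    obtain ⟨j, p, hj, rfl⟩ := hf
    exact AddSubgroup.subset_closure ⟨j, p.stackR c, by rw [Movie.deg_stackR]; exact hj,
      by rw [map_smul, Cob.stackR_toCob]⟩

/-- The graded category `Cob^m_n`: the objects are the formal degree shifts `q^k a` of diagrams.
The degree of `f : q^k a → q^l b` is its degree as a map of unshifted diagrams plus `l - k`, and the
morphisms are those of degree zero. -/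
structure GCob (m n : ℕ) where
  /-- the exponent of `q` -/
  shift : ℤ
  /-- the diagram -/
  diag : Diag m n

/-- The morphisms of degree zero `q^k a → q^l b`. -/
abbrev GCob.Hom {m n : ℕ} (x y : GCob m n) : Type :=
  Cob.homogeneous x.diag y.diag (x.shift - y.shift)

noncomputable instance {m n : ℕ} : Category (GCob m n) where
  Hom x y := GCob.Hom x y
  id x := ⟨𝟙 _, by rw [sub_self]; exact Cob.id_mem _⟩
  comp {x y z} f g := ⟨f.1 ≫ g.1, by
    have := Cob.comp_mem f.2 g.2
    rwa [sub_add_sub_cancel] at this⟩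
  id_comp f := Subtype.ext (Category.id_comp f.1)
  comp_id f := Subtype.ext (Category.comp_id f.1)
  assoc f g h := Subtype.ext (Category.assoc f.1 g.1 h.1)

noncomputable instance {m n : ℕ} : Preadditive (GCob m n) where
  homGroup x y := inferInstanceAs (AddCommGroup (GCob.Hom x y))
  add_comp _ _ _ f f' g := Subtype.ext (Preadditive.add_comp _ _ _ f.1 f'.1 g.1)
  comp_add _ _ _ f g g' := Subtype.ext (Preadditive.comp_add _ _ _ f.1 g.1 g'.1)

/-- The functor `⊗ : Cob^m_k × Cob^k_n ⥤ Cob^m_n`, vertical stacking of diagrams and of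
cobordisms. -/
noncomputable def GCob.tensor (m k n : ℕ) : GCob m k ⥤ GCob k n ⥤ GCob m n where
  obj x :=
    { obj := fun y => ⟨x.shift + y.shift, x.diag.stack y.diag⟩
      map := fun {y y'} g => ⟨Cob.stackL x.diag g.1, by
        rw [add_sub_add_left_eq_sub]
        exact Cob.stackL_mem x.diag g.2⟩
      map_id := fun y => Subtype.ext (Cob.stackL_id _ _)
      map_comp := fun f g => Subtype.ext (Cob.stackL_comp _ f.1 g.1) }
  map {x x'} f :=
    { app := fun y => ⟨Cob.stackR y.diag f.1, by
        dsimp only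
        rw [add_sub_add_right_eq_sub]
        exact Cob.stackR_mem y.diag f.2⟩
      naturality := fun y y' g => Subtype.ext (Cob.interchange f.1 g.1).symm }
  map_id x := NatTrans.ext (funext fun y => Subtype.ext (Cob.stackR_id _ _))
  map_comp f g := NatTrans.ext (funext fun y =>
    Subtype.ext (Cob.stackR_comp _ f.1 g.1))

instance (m k n : ℕ) : (GCob.tensor m k n).Additive where
  map_add {_ _ f f'} := NatTrans.ext (funext fun y =>
    Subtype.ext (map_add (Cob.stackR y.diag) f.1 f'.1))

instance {m k : ℕ} (n : ℕ) (x : GCob m k) : ((GCob.tensor m k n).obj x).Additive where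
  map_add {_ _ g g'} := Subtype.ext (map_add (Cob.stackL x.diag) g.1 g'.1)

/-! ## Countable direct sums -/

/-- The objects of the closure `C^⊕` of a preadditive category `C` under countable direct sums:
the symbols `⨁ i, X i`, with a countable index set. -/
structure CSum (C : Type*) where
  /-- the index set -/
  ι : Type
  [countable : Countable ι]
  /-- the summands -/
  X : ι → C

namespace CSum

attribute [instance] CSum.countable

universe v u v₁ u₁ v₂ u₂

variable {C : Type u} [Category.{v} C] [Preadditive C]

/-- The finite columns of morphisms from an object `A` of `C` to the summands of `N`. -/
abbrev Col (A : C) (N : CSum C) : Type v := Π₀ j : N.ι, (A ⟶ N.X j)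

/-- The morphisms of `C^⊕`: matrices with finite columns, i.e. for each `i` the morphisms
`f i j : M.X i ⟶ N.X j` vanish for all but finitely many `j`. -/
abbrev Hom (M N : CSum C) : Type v := ∀ i : M.ι, Col (M.X i) N

open scoped Classical in
/-- The column with only one entry `φ`, in the place `j`. -/
noncomputable def entry {A : C} (N : CSum C) (j : N.ι) : (A ⟶ N.X j) →+ Col A N :=
  DFinsupp.singleAddHom (fun j : N.ι => (A ⟶ N.X j)) j

open scoped Classical in
theorem entry_apply {A : C} (N : CSum C) (j k : N.ι) (φ : A ⟶ N.X j) :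
    entry N j φ k = if h : j = k then φ ≫ eqToHom (congrArg N.X h) else 0 := by
  by_cases h : j = k
  · subst h; simp [entry]
  · rw [dif_neg h]
    exact DFinsupp.single_eq_of_ne (Ne.symm h)

theorem col_induction {A : C} {N : CSum C} {P : Col A N → Prop} (zero : P 0)
    (add : ∀ x y, P x → P y → P (x + y)) (entry : ∀ j φ, P (entry N j φ)) (x : Col A N) : P x := by
  classical
  induction x using DFinsupp.induction with
  | h0 => exact zero
  | ha j φ x _ _ ih =>
    refine add _ _ ?_ ih
    convert entry j φ
    exact DFinsupp.singleAddHom_apply _ _ _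

open scoped Classical in
/-- The additive map on columns with given values on the columns with one entry. -/
noncomputable def extend {A : C} {N : CSum C} {G : Type*} [AddCommMonoid G]
    (f : ∀ j : N.ι, (A ⟶ N.X j) →+ G) : Col A N →+ G :=
  DFinsupp.liftAddHom f

@[simp]
theorem extend_entry {A : C} {N : CSum C} {G : Type*} [AddCommMonoid G]
    (f : ∀ j : N.ι, (A ⟶ N.X j) →+ G) (j : N.ι) (φ : A ⟶ N.X j) :
    extend f (entry N j φ) = f j φ := by
  classical
  exact DFinsupp.liftAddHom_apply_single f j φ

/-- Precomposition of a column with a morphism. -/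
def precomp (N : CSum C) {A B : C} : (A ⟶ B) →+ Col B N →+ Col A N where
  toFun φ := DFinsupp.mapRange.addMonoidHom fun j => Preadditive.leftComp (N.X j) φ
  map_zero' := by ext; simp [Preadditive.leftComp]
  map_add' φ ψ := by ext; simp [Preadditive.leftComp]

@[simp]
theorem precomp_apply (N : CSum C) {A B : C} (φ : A ⟶ B) (x : Col B N) (j : N.ι) :
    precomp N φ x j = φ ≫ x j := by
  simp [precomp, Preadditive.leftComp]

theorem precomp_precomp (N : CSum C) {A B B' : C} (φ : A ⟶ B) (ψ : B ⟶ B') (x : Col B' N) :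
    precomp N φ (precomp N ψ x) = precomp N (φ ≫ ψ) x := by
  ext; simp

theorem precomp_id (N : CSum C) (A : C) (x : Col A N) : precomp N (𝟙 A) x = x := by
  ext; simp

@[simp]
theorem precomp_entry (N : CSum C) {A B : C} (φ : A ⟶ B) (j : N.ι) (ψ : B ⟶ N.X j) :
    precomp N φ (entry N j ψ) = entry N j (φ ≫ ψ) := by
  ext k
  rw [precomp_apply, entry_apply, entry_apply]
  split_ifs <;> simp

/-- Multiplication of the matrix `g` with a column: `(∑ j, x j) ↦ ∑ j, x j ≫ g j`. -/
noncomputable def push {N P : CSum C} (g : Hom N P) (A : C) : Col A N →+ Col A P :=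
  extend fun j => (precomp P).flip (g j)

@[simp]
theorem push_entry {N P : CSum C} (g : Hom N P) (A : C) (j : N.ι) (φ : A ⟶ N.X j) :
    push g A (entry N j φ) = precomp P φ (g j) := by
  simp [push]

theorem push_precomp {N P : CSum C} (g : Hom N P) {A B : C} (φ : A ⟶ B) (x : Col B N) :
    push g A (precomp N φ x) = precomp P φ (push g B x) := by
  induction x using col_induction with
  | zero => simp
  | add x y hx hy => simp [map_add, hx, hy]
  | entry j ψ => simp [precomp_precomp]

/-- Matrix multiplication. -/
noncomputable def comp {M N P : CSum C} (f : Hom M N) (g : Hom N P) : Hom M P :=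
  fun i => push g (M.X i) (f i)

theorem push_comp {N P R : CSum C} (g : Hom N P) (h : Hom P R) (A : C) (x : Col A N) :
    push (comp g h) A x = push h A (push g A x) := by
  induction x using col_induction with
  | zero => simp
  | add x y hx hy => simp [map_add, hx, hy]
  | entry j ψ => simp [push_precomp, comp]

theorem push_id (N : CSum C) (A : C) (x : Col A N) :
    push (fun i => entry N i (𝟙 (N.X i))) A x = x := by
  induction x using col_induction with
  | zero => simp
  | add x y hx hy => simp [map_add, hx, hy]
  | entry j ψ => simp

/-- The category `C^⊕`. -/
noncomputable instance : Category (CSum C) where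
  Hom M N := Hom M N
  id M := fun i => entry M i (𝟙 (M.X i))
  comp f g := comp f g
  id_comp {_ N} f := funext fun i => (push_entry f _ i _).trans (precomp_id N _ _)
  comp_id {_ N} f := funext fun i => push_id N _ (f i)
  assoc f g h := funext fun i => (push_comp g h _ (f i)).symm

theorem push_add {N P : CSum C} (g g' : Hom N P) (A : C) (x : Col A N) :
    push (g + g') A x = push g A x + push g' A x := by
  induction x using col_induction with
  | zero => simp
  | add x y hx hy => simp only [map_add, hx, hy]; abel
  | entry j ψ => simp

noncomputable instance : Preadditive (CSum C) where
  homGroup M N := inferInstanceAs (AddCommGroup (Hom M N))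
  add_comp _ _ _ f f' g := funext fun i => map_add (push g _) (f i) (f' i)
  comp_add _ _ _ f g g' := funext fun i => push_add g g' _ (f i)

/-! ### Coproducts -/

/-- The direct sum of a countable family. -/
abbrev sigma {J : Type} [Countable J] (M : J → CSum C) : CSum C :=
  ⟨Σ j, (M j).ι, fun p => (M p.1).X p.2⟩

/-- The inclusions of the summands. -/
noncomputable def sigmaι {J : Type} [Countable J] (M : J → CSum C) (j : J) : M j ⟶ sigma M :=
  fun i => entry (sigma M) ⟨j, i⟩ (𝟙 ((M j).X i))

theorem sigmaι_comp {J : Type} [Countable J] (M : J → CSum C) {T : CSum C} (f : sigma M ⟶ T)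
    (j : J) (i : (M j).ι) : (sigmaι M j ≫ f) i = f ⟨j, i⟩ :=
  (push_entry (N := sigma M) f _ ⟨j, i⟩ (𝟙 _)).trans (precomp_id T _ _)

/-- `C^⊕` has countable direct sums. -/
instance {J : Type} [Countable J] (M : J → CSum C) : HasCoproduct M :=
  ⟨⟨⟨Cofan.mk (sigma M) (sigmaι M), Cofan.IsColimit.mk _ (fun s p => s.inj p.1 p.2)
    (fun s j => funext fun i => sigmaι_comp M (T := s.pt) (fun p => s.inj p.1 p.2) j i)
    (fun s f h => funext fun p => by
      rw [← h p.1]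
      exact (sigmaι_comp M f p.1 p.2).symm)⟩⟩⟩

/-! ### Finite direct sums -/

/-- A finite direct sum as a countable direct sum. -/
abbrev ofMatObj (M : Mat_ C) : CSum C := ⟨M.ι, M.X⟩

/-- A finite matrix as a matrix with finite columns. -/
noncomputable def ofMatMap {M N : Mat_ C} (f : M ⟶ N) : Hom (ofMatObj M) (ofMatObj N) :=
  fun i => ∑ j : N.ι, entry (ofMatObj N) j (f i j)

/-- The inclusion of the additive closure `Mat_ C` of `C` (finite direct sums) into `C^⊕`. -/
noncomputable def ofMat : Mat_ C ⥤ CSum C where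
  obj M := ofMatObj M
  map f := ofMatMap f
  map_id M := funext fun i => by
    refine (Finset.sum_eq_single i ?_ ?_).trans ?_
    · intro j _ hj
      rw [Mat_.id_apply_of_ne _ _ _ (Ne.symm hj), map_zero]
    · simp
    · rw [Mat_.id_apply_self]
      rfl
  map_comp {M N P} f g := funext fun i => by
    have h : ∀ j : N.ι, push (ofMatMap g) (M.X i) (entry (ofMatObj N) j (f i j)) =
        ∑ k : P.ι, entry (ofMatObj P) k (f i j ≫ g j k) := by
      intro j
      rw [push_entry, ofMatMap, map_sum]
      exact Finset.sum_congr rfl fun k _ => precomp_entry _ _ _ _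
    refine Eq.trans ?_ (map_sum (push (ofMatMap g) (M.X i)) _ _).symm
    refine Eq.trans ?_ (Finset.sum_congr rfl fun j _ => h j).symm
    refine Eq.trans ?_ Finset.sum_comm
    exact Finset.sum_congr rfl fun k _ => map_sum (entry (ofMatObj P) k) _ _

instance : (ofMat (C := C)).Additive where
  map_add {M N f g} := funext fun i => by
    refine Eq.trans ?_ Finset.sum_add_distrib
    exact Finset.sum_congr rfl fun j _ => map_add (entry (ofMatObj N) j) (f i j) (g i j)

/-! ### Extension of bifunctors -/

variable {D : Type u₁} {E : Type u₂} [Category.{v₁} D] [Preadditive D] [Category.{v₂} E]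
  [Preadditive E] (F : C ⥤ D ⥤ E) [F.Additive] [∀ X, (F.obj X).Additive]

instance (Y : D) : (F.flip.obj Y).Additive where
  map_add := by simp [Functor.map_add]

/-- `(⨁ i, a i) ⊗ (⨁ j, b j) = ⨁ (i, j), a i ⊗ b j`. -/
abbrev tensorObj (M : CSum C) (N : CSum D) : CSum E :=
  ⟨M.ι × N.ι, fun p => (F.obj (M.X p.1)).obj (N.X p.2)⟩

/-- A column of morphisms `B ⟶ N.X j` gives a column of morphisms `M.X i ⊗ B ⟶ M.X i ⊗ N.X j`. -/
noncomputable def colR (M : CSum C) (N : CSum D) (i : M.ι) (B : D) :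
    Col B N →+ Col ((F.obj (M.X i)).obj B) (tensorObj F M N) :=
  extend fun j => (entry (tensorObj F M N) (i, j)).comp (F.obj (M.X i)).mapAddHom

/-- A column of morphisms `A ⟶ M.X i` gives a column of morphisms `A ⊗ N.X j ⟶ M.X i ⊗ N.X j`. -/
noncomputable def colL (M : CSum C) (N : CSum D) (j : N.ι) (A : C) :
    Col A M →+ Col ((F.obj A).obj (N.X j)) (tensorObj F M N) :=
  extend fun i => (entry (tensorObj F M N) (i, j)).comp (F.flip.obj (N.X j)).mapAddHom

@[simp]
theorem colR_entry (M : CSum C) (N : CSum D) (i : M.ι) (B : D) (j : N.ι) (ψ : B ⟶ N.X j) :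
    colR F M N i B (entry N j ψ) = entry (tensorObj F M N) (i, j) ((F.obj (M.X i)).map ψ) :=
  extend_entry _ _ _

@[simp]
theorem colL_entry (M : CSum C) (N : CSum D) (j : N.ι) (A : C) (i : M.ι) (φ : A ⟶ M.X i) :
    colL F M N j A (entry M i φ) = entry (tensorObj F M N) (i, j) ((F.map φ).app (N.X j)) :=
  extend_entry _ _ _

/-- `1_M ⊗ g`. -/
noncomputable def tensorR (M : CSum C) {N N' : CSum D} (g : Hom N N') :
    Hom (tensorObj F M N) (tensorObj F M N') :=
  fun p => colR F M N' p.1 (N.X p.2) (g p.2)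

/-- `f ⊗ 1_N`. -/
noncomputable def tensorL {M M' : CSum C} (f : Hom M M') (N : CSum D) :
    Hom (tensorObj F M N) (tensorObj F M' N) :=
  fun p => colL F M' N p.2 (M.X p.1) (f p.1)

theorem colR_precomp (M : CSum C) (N : CSum D) (i : M.ι) {A B : D} (φ : A ⟶ B) (x : Col B N) :
    colR F M N i A (precomp N φ x) =
      precomp (tensorObj F M N) ((F.obj (M.X i)).map φ) (colR F M N i B x) := by
  induction x using col_induction with
  | zero => simp only [map_zero]
  | add x y hx hy => simp only [map_add, hx, hy]
  | entry j ψ => rw [precomp_entry, colR_entry, colR_entry, precomp_entry, Functor.map_comp]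

theorem colL_precomp (M : CSum C) (N : CSum D) (j : N.ι) {A B : C} (φ : A ⟶ B) (x : Col B M) :
    colL F M N j A (precomp M φ x) =
      precomp (tensorObj F M N) ((F.map φ).app (N.X j)) (colL F M N j B x) := by
  induction x using col_induction with
  | zero => simp only [map_zero]
  | add x y hx hy => simp only [map_add, hx, hy]
  | entry i ψ =>
    rw [precomp_entry, colL_entry, colL_entry, precomp_entry, Functor.map_comp, NatTrans.comp_app]

theorem push_colR (M : CSum C) {N N' : CSum D} (g : Hom N N') (i : M.ι) (B : D) (x : Col B N) :
    push (tensorR F M g) _ (colR F M N i B x) = colR F M N' i B (push g B x) := by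
  induction x using col_induction with
  | zero => simp only [map_zero]
  | add x y hx hy => simp only [map_add, hx, hy]
  | entry j ψ => rw [colR_entry, push_entry, push_entry, colR_precomp, tensorR]

theorem push_colL {M M' : CSum C} (f : Hom M M') (N : CSum D) (j : N.ι) (A : C) (x : Col A M) :
    push (tensorL F f N) _ (colL F M N j A x) = colL F M' N j A (push f A x) := by
  induction x using col_induction with
  | zero => simp only [map_zero]
  | add x y hx hy => simp only [map_add, hx, hy]
  | entry i ψ => rw [colL_entry, push_entry, push_entry, colL_precomp, tensorL]

theorem tensor_naturality {M M' : CSum C} (f : Hom M M') {N N' : CSum D} (g : Hom N N') :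
    comp (tensorR F M g) (tensorL F f N') = comp (tensorL F f N) (tensorR F M' g) := by
  funext p
  obtain ⟨i, j⟩ := p
  change push (tensorL F f N') _ (colR F M N' i (N.X j) (g j)) =
    push (tensorR F M' g) _ (colL F M' N j (M.X i) (f i))
  have h₁ : ∀ y : Col (N.X j) N', push (tensorL F f N') _ (colR F M N' i (N.X j) y) =
      extend (fun j' => ((precomp (tensorObj F M' N')).flip
        (colL F M' N' j' (M.X i) (f i))).comp (F.obj (M.X i)).mapAddHom) y := by
    intro y
    induction y using col_induction with
    | zero => simp only [map_zero]
    | add x y hx hy => simp only [map_add, hx, hy]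
    | entry j' ψ => rw [colR_entry, push_entry, extend_entry]; rfl
  have h₂ : ∀ x : Col (M.X i) M', push (tensorR F M' g) _ (colL F M' N j (M.X i) x) =
      extend (fun i' => ((precomp (tensorObj F M' N')).flip
        (colR F M' N' i' (N.X j) (g j))).comp (F.flip.obj (N.X j)).mapAddHom) x := by
    intro x
    induction x using col_induction with
    | zero => simp only [map_zero]
    | add x y hx hy => simp only [map_add, hx, hy]
    | entry i' φ => rw [colL_entry, push_entry, extend_entry]; rfl
  rw [h₁, h₂]
  generalize f i = x
  generalize g j = y
  induction y using col_induction with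
  | zero =>
    induction x using col_induction with
    | zero => simp only [map_zero]
    | add x y hx hy => rw [map_add, ← hx, ← hy]; simp only [map_zero, add_zero]
    | entry i' φ => rw [extend_entry]; simp
  | add y y' hy hy' =>
    rw [map_add, hy, hy']
    clear hy hy' h₁ h₂
    induction x using col_induction with
    | zero => simp only [map_zero, add_zero]
    | add x x' hx hx' => rw [map_add, map_add, map_add, ← hx, ← hx']; abel
    | entry i' φ => rw [extend_entry, extend_entry, extend_entry]; simp
  | entry j' ψ =>
    rw [extend_entry]
    clear h₁ h₂
    induction x using col_induction with
    | zero => simp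
    | add x x' hx hx' =>
      refine Eq.trans ?_ (map_add _ _ _).symm
      rw [← hx, ← hx']
      simp [map_add]
    | entry i' φ =>
      rw [extend_entry]
      change precomp _ ((F.obj (M.X i)).map ψ) (colL F M' N' j' (M.X i) (entry M' i' φ)) =
        precomp _ ((F.map φ).app (N.X j)) (colR F M' N' i' (N.X j) (entry N' j' ψ))
      rw [colL_entry, colR_entry, precomp_entry, precomp_entry, NatTrans.naturality]

/-- The extension of a biadditive functor `F` to countable direct sums. -/
noncomputable def tensor : CSum C ⥤ CSum D ⥤ CSum E where
  obj M :=
    { obj := fun N => tensorObj F M N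
      map := fun g => tensorR F M g
      map_id := fun N => funext fun p => by
        refine (colR_entry F M N p.1 _ p.2 (𝟙 _)).trans ?_
        rw [CategoryTheory.Functor.map_id]
        rfl
      map_comp := fun {N N' N''} g h => funext fun p => (push_colR F M h p.1 _ (g p.2)).symm }
  map {M M'} f :=
    { app := fun N => tensorL F f N
      naturality := fun N N' g => tensor_naturality F f g }
  map_id M := NatTrans.ext (funext fun N => funext fun p => by
    refine (colL_entry F M N p.2 _ p.1 (𝟙 _)).trans ?_
    rw [CategoryTheory.Functor.map_id, NatTrans.id_app]
    rfl)
  map_comp {M M' M''} f g := NatTrans.ext (funext fun N => funext fun p =>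
    (push_colL F g N p.2 _ (f p.1)).symm)

instance : (tensor F).Additive where
  map_add {M M' f g} := NatTrans.ext (funext fun N => funext fun p =>
    map_add (colL F M' N p.2 (M.X p.1)) (f p.1) (g p.1))

instance (M : CSum C) : ((tensor F).obj M).Additive where
  map_add {N N' f g} := funext fun p => map_add (colR F M N' p.1 (N.X p.2)) (f p.2) (g p.2)


end CSum

/-! ## Complexes over `BN^m_n` and `(BN^m_n)^⊕` -/

/-- `BN^m_n`: formal finite direct sums of shifted diagrams with `m` points on the top and `n` points
on the bottom, with matrices of morphisms of degree zero. -/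
abbrev BN (m n : ℕ) := Mat_ (GCob m n)

/-- `(BN^m_n)^⊕`: formal countable direct sums of shifted diagrams, with matrices with finite columns
of morphisms of degree zero. -/
abbrev BNSum (m n : ℕ) := CSum (GCob m n)

/-- The inclusion of complexes over `BN^m_n` into complexes over `(BN^m_n)^⊕`. -/
noncomputable abbrev toBNSum {m n : ℕ} (K : CochainComplex (BN m n) ℤ) :
    CochainComplex (BNSum m n) ℤ :=
  (CSum.ofMat.mapHomologicalComplex (ComplexShape.up ℤ)).obj K

/-- A cochain complex is contractible if its identity map is null-homotopic. -/
def Contractible {C : Type*} [Category* C] [Preadditive C] (K : CochainComplex C ℤ) : Prop :=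
  Nonempty (Homotopy (𝟙 K) 0)

/-- A cochain complex is bounded below if its chain objects vanish in all sufficiently negative
degrees. -/
def BoundedBelow {C : Type*} [Category* C] [HasZeroMorphisms C] (K : CochainComplex C ℤ) : Prop :=
  ∃ b : ℤ, ∀ i < b, IsZero (K.X i)

/-- A cochain complex is bounded above if its chain objects vanish in all sufficiently positive
degrees. -/
def BoundedAbove {C : Type*} [Category* C] [HasZeroMorphisms C] (K : CochainComplex C ℤ) : Prop :=
  ∃ b : ℤ, ∀ i > b, IsZero (K.X i)

instance {k n : ℕ} (m : ℕ) (x : GCob k n) : ((GCob.tensor k n m).obj x).mapMat_.Additive where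
  map_add {_ _ f g} := funext fun i => funext fun j =>
    ((GCob.tensor k n m).obj x).map_add (f := f i j) (g := g i j)

/-- The complex `a ⊗ Q`, for a diagram `a` and a complex `Q`. -/
noncomputable def stackComplex {k n m : ℕ} (a : Diag k n) (Q : CochainComplex (BN n m) ℤ) :
    CochainComplex (BN k m) ℤ :=
  (((GCob.tensor k n m).obj ⟨0, a⟩).mapMat_.mapHomologicalComplex (ComplexShape.up ℤ)).obj Q

/-- `Q` kills turnbacks from above: `a_i ⊗ Q ≃ 0` for all the turnbacks `a_i`, `0 ≤ i ≤ n - 2`. -/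
def KillsTurnbacksAbove {n m : ℕ} (Q : CochainComplex (BN n m) ℤ) : Prop :=
  ∀ {k : ℕ} (a : Diag k n), IsTurnback a → Contractible (stackComplex a Q)

/-- The through-degree of a complex: the supremum of the through-degrees of all direct summands of
all its chain objects. -/
noncomputable def throughDegree {m n : ℕ} (N : CochainComplex (BNSum m n) ℤ) : WithBot ℕ∞ :=
  ⨆ (i : ℤ) (x : (N.X i).ι), ((((N.X i).X x).diag.throughDegree : ℕ∞) : WithBot ℕ∞)

/-- The tensor product `N ⊗ Q` of complexes, by vertical stacking: the total complex with
`(N ⊗ Q)^l = ⨁_{i + j = l} N^i ⊗ Q^j` and with the differential `d ⊗ 1 + (-1)^i 1 ⊗ d` on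
`N^i ⊗ Q^j`. -/
noncomputable def tensorComplex {k n m : ℕ} (N : CochainComplex (BNSum k n) ℤ)
    (Q : CochainComplex (BNSum n m) ℤ) : CochainComplex (BNSum k m) ℤ :=
  HomologicalComplex.mapBifunctor N Q (CSum.tensor (GCob.tensor k n m)) (ComplexShape.up ℤ)

end BarNatan

/-! The proof has two independent halves: every row `N^i ⊗ Q` is contractible, and a total complex
with contractible rows is contractible under either boundedness condition.

Rows. Let `c` be a diagram of through-degree less than `n`. Up to isotopy `c = a ⊗ b`, where `b` has
fewer than `n` top points. Push each maximum of `b` down through the minima below it. It exchanges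
heights with a distant minimum, cancels against a neighbouring one, closes up to a circle with one
in the same position, or reaches the bottom and becomes a turnback. Without a turnback at the
bottom, all maxima would disappear, and `b` would have at least `n` top points. Hence `b` reduces to
a diagram obtained by stacking something on a turnback, and such a diagram kills `Q`. The reduction
requires no decomposition of diagrams into direct sums. The relation `Factors c w` says only that
the identity of `c` is a sum of homogeneous maps through `w`; isotopies and neck-cutting provide
such sums, and the relation is transitive and stable under stacking (`exists_endsWithTurnback`).
Since null-homotopic maps are closed under sums and compositions, contractibility passes from all
shifts of `w ⊗ Q` to `c ⊗ Q` (`Factors.contractible`). Homotopies for the summands of `N^i` then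
combine to one for the row (`contractible_tensor_row`).

Total complex. The row homotopies, with signs, assemble to a map `H` of degree `-1`. The error `1 -
(dH + Hd)` sends the summand `(i, j)` into `(i + 1, j - 1)`, because the row homotopies need not
commute with the differential of `N`. If `Q` is bounded below or `N` bounded above, iterating the
error on a fixed summand eventually gives zero. So the geometric series is finite on each summand,
and this suffices to define it on a direct sum, even without a uniform bound. Therefore `dH + Hd` is
a null-homotopic isomorphism, and the complex is contractible (`contractible_mapBifunctor`). -/

namespace BarNatan

/-! ## Contractible complexes -/

section Contractible

variable {A : Type*} [Category* A] [Preadditive A]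

/-- Only the components of `h` that lower the degree by one enter, so its other values are
unrestricted. Indexing by all pairs avoids transport along equalities of degrees. -/
theorem contractible_of_hom {K : CochainComplex A ℤ} (h : ∀ i j : ℤ, K.X i ⟶ K.X j)
    (H : ∀ i j l : ℤ, i + 1 = j → l + 1 = i → K.d i j ≫ h j i + h i l ≫ K.d l i = 𝟙 _) :
    Contractible K := by
  have e : Homotopy.nullHomotopicMap' (fun i j _ => h i j) = 𝟙 K := by
    ext i
    rw [Homotopy.nullHomotopicMap'_f (k₂ := i - 1) (k₁ := i) (k₀ := i + 1) (by simp) (by simp)]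
    exact H i _ _ rfl (by ring)
  exact ⟨(Homotopy.ofEq e.symm).trans (Homotopy.nullHomotopy' _)⟩

theorem Contractible.exists_hom {K : CochainComplex A ℤ} (hK : Contractible K) :
    ∃ h : ∀ i j : ℤ, K.X i ⟶ K.X j,
      ∀ i j l : ℤ, i + 1 = j → l + 1 = i → K.d i j ≫ h j i + h i l ≫ K.d l i = 𝟙 _ := by
  obtain ⟨h⟩ := hK
  refine ⟨h.hom, ?_⟩
  rintro i j l hj hl
  have := h.comm i
  rw [dNext_eq h.hom (i' := j) (by simpa using hj),
    prevD_eq h.hom (j' := l) (by simpa using hl)] at this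
  simpa using this.symm

/-- Composing the null-homotopy with the inverse of `f` contracts the identity. Thus a candidate
contraction `H` need not satisfy `dH + Hd = 1`; invertibility of `dH + Hd` is enough. -/
theorem Contractible.of_isIso {K : CochainComplex A ℤ} {f : K ⟶ K} [IsIso f]
    (h : Homotopy f 0) : Contractible K :=
  ⟨(Homotopy.ofEq (IsIso.hom_inv_id f).symm).trans
    ((h.compRight (inv f)).trans (Homotopy.ofEq zero_comp))⟩

theorem Contractible.of_retract {K L : CochainComplex A ℤ} (hL : Contractible L) (f : K ⟶ L)
    (g : L ⟶ K) (h : f ≫ g = 𝟙 K) : Contractible K := by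
  obtain ⟨t⟩ := hL
  refine ⟨(Homotopy.ofEq ?_).trans (((t.compLeft f).compRight g).trans (Homotopy.ofEq ?_))⟩
  · simpa using h.symm
  · simp

theorem Contractible.map {B : Type*} [Category* B] [Preadditive B] (F : A ⥤ B) [F.Additive]
    {K : CochainComplex A ℤ} (hK : Contractible K) :
    Contractible ((F.mapHomologicalComplex (ComplexShape.up ℤ)).obj K) := by
  obtain ⟨t⟩ := hK
  refine ⟨(Homotopy.ofEq ?_).trans ((F.mapHomotopy t).trans (Homotopy.ofEq ?_))⟩
  · simp
  · simp

/-- A complex whose identity map is a sum of maps which factor through contractible complexes is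
contractible. -/
theorem contractible_of_mem_closure {K : CochainComplex A ℤ}
    (h : 𝟙 K ∈ AddSubgroup.closure {f : K ⟶ K | ∃ (L : CochainComplex A ℤ) (g : K ⟶ L) (g' : L ⟶ K),
      Contractible L ∧ f = g ≫ g'}) : Contractible K := by
  suffices ∀ f ∈ AddSubgroup.closure {f : K ⟶ K | ∃ (L : CochainComplex A ℤ) (g : K ⟶ L)
      (g' : L ⟶ K), Contractible L ∧ f = g ≫ g'}, Nonempty (Homotopy f 0) from this _ h
  intro f hf
  induction hf using AddSubgroup.closure_induction with
  | mem f hf =>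
    obtain ⟨L, g, g', ⟨t⟩, rfl⟩ := hf
    refine ⟨(Homotopy.ofEq ?_).trans (((t.compLeft g).compRight g').trans (Homotopy.ofEq ?_))⟩
    · simp
    · simp
  | zero => exact ⟨Homotopy.refl 0⟩
  | add f g _ _ hf hg =>
    obtain ⟨s⟩ := hf
    obtain ⟨t⟩ := hg
    exact ⟨(s.add t).trans (Homotopy.ofEq (add_zero 0))⟩
  | neg f _ hf =>
    obtain ⟨s⟩ := hf
    exact ⟨(Homotopy.ofEq (zero_sub f).symm).trans (Homotopy.equivSubZero s.symm)⟩

/-- An endomorphism of a direct sum is invertible if its difference from the identity maps each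
summand to a single summand and is nilpotent on each summand. -/
theorem isIso_of_locally_nilpotent {S : Type*} {Y : S → A} {T : A} (ι : ∀ s, Y s ⟶ T)
    (desc : ∀ g : ∀ s, Y s ⟶ T, ∃ ψ : T ⟶ T, ∀ s, ι s ≫ ψ = g s)
    (ext : ∀ φ ψ : T ⟶ T, (∀ s, ι s ≫ φ = ι s ≫ ψ) → φ = ψ)
    (f : T ⟶ T) (σ : S → S) (p : ∀ s, Y s ⟶ Y (σ s))
    (hp : ∀ s, ι s ≫ (𝟙 T - f) = p s ≫ ι (σ s))
    (hz : ∀ s, ∃ K, IsZero (Y (σ^[K] s))) : IsIso f := by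
  obtain ⟨x, rfl⟩ : ∃ x : T ⟶ T, f = 𝟙 T - x := ⟨𝟙 T - f, (sub_sub_cancel _ _).symm⟩
  rw [sub_sub_cancel] at hp
  -- Multiplication in `End T` is composition in the reverse order, so `pow_succ` splits off the
  -- first map applied and `pow_succ'` the last.
  let P : ℕ → (T ⟶ T) := fun k => (show End T from x) ^ k
  have P_zero : P 0 = 𝟙 T := rfl
  have P_succ : ∀ k, P (k + 1) = x ≫ P k := fun k => pow_succ (show End T from x) k
  have P_succ' : ∀ k, P (k + 1) = P k ≫ x := fun k => pow_succ' (show End T from x) k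
  have hpow : ∀ K s, IsZero (Y (σ^[K] s)) → ι s ≫ P K = 0 := by
    intro K
    induction K with
    | zero => intro s h; exact h.eq_of_src _ _
    | succ K ih => intro s h; rw [P_succ, ← Category.assoc, hp, Category.assoc, ih _ h, comp_zero]
  have hpow' : ∀ {K L s}, IsZero (Y (σ^[K] s)) → K ≤ L → ι s ≫ P L = 0 := by
    intro K L s h hKL
    induction L, hKL using Nat.le_induction with
    | base => exact hpow K s h
    | succ L _ ih => rw [P_succ', ← Category.assoc, ih, zero_comp]
  have sum_comp : ∀ L, (∑ k ∈ Finset.range L, P k) ≫ (𝟙 T - x) = 𝟙 T - P L := by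
    intro L
    induction L with
    | zero => simp [P_zero]
    | succ L ih =>
      rw [Finset.sum_range_succ, Preadditive.add_comp, ih, Preadditive.comp_sub, Category.comp_id,
        ← P_succ']
      abel
  have comp_sum : ∀ L, (𝟙 T - x) ≫ (∑ k ∈ Finset.range L, P k) = 𝟙 T - P L := by
    intro L
    induction L with
    | zero => simp [P_zero]
    | succ L ih =>
      rw [Finset.sum_range_succ, Preadditive.comp_add, ih, Preadditive.sub_comp, Category.id_comp,
        ← P_succ]
      abel
  choose K hK using hz
  -- The inverse of `1 - x` is the geometric series, truncated on each summand at its own length `K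
  -- s`. By `key`, longer truncations give the same map.
  obtain ⟨ψ, hψ⟩ := desc fun s => ι s ≫ ∑ k ∈ Finset.range (K s), P k
  have key : ∀ s L, K s ≤ L → ι s ≫ ψ = ι s ≫ ∑ k ∈ Finset.range L, P k := by
    intro s L hL
    induction L, hL using Nat.le_induction with
    | base => exact hψ s
    | succ L hL ih =>
      rw [ih, Finset.sum_range_succ, Preadditive.comp_add, hpow' (hK s) hL, add_zero]
  refine ⟨ψ, ext _ _ fun s => ?_, ext _ _ fun s => ?_⟩
  -- `x` moves the summand `s` to `σ s`, where `ψ` is truncated at another length; the maximum of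
  -- both lengths serves for the two summands at once.
  · have h : ι s ≫ (𝟙 T - x) ≫ ψ =
        ι s ≫ (𝟙 T - x) ≫ ∑ k ∈ Finset.range (max (K s) (K (σ s))), P k := by
      simp only [Preadditive.sub_comp, Preadditive.comp_sub, Category.id_comp]
      rw [key _ _ (le_max_left _ (K (σ s))), ← Category.assoc, ← Category.assoc, hp,
        Category.assoc, Category.assoc, key _ _ (le_max_right (K s) _)]
    rw [h, comp_sum, Preadditive.comp_sub, hpow' (hK s) (le_max_left _ _), sub_zero]
  · rw [← Category.assoc, hψ, Category.assoc, sum_comp, Preadditive.comp_sub, hpow _ _ (hK s),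
      sub_zero]

end Contractible

/-! ### Total complexes with contractible rows -/

section Total

open HomologicalComplex

variable {A B E : Type*} [Category* A] [Preadditive A] [Category* B] [Preadditive B] [Category* E]
  [Preadditive E] (F : A ⥤ B ⥤ E) [F.Additive] [∀ X, (F.obj X).Additive]

/-- A total complex with contractible rows is contractible if the second factor is bounded below or
the first factor is bounded above. -/
theorem contractible_mapBifunctor (N : CochainComplex A ℤ) (Q : CochainComplex B ℤ)
    [HasMapBifunctor N Q F (ComplexShape.up ℤ)]
    (hrow : ∀ i, Contractible (((F.obj (N.X i)).mapHomologicalComplex (ComplexShape.up ℤ)).obj Q))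
    (hb : BoundedBelow Q ∨ BoundedAbove N) :
    Contractible (mapBifunctor N Q F (ComplexShape.up ℤ)) := by
  have hrow' : ∀ i, ∃ h : ∀ a b : ℤ,
      (F.obj (N.X i)).obj (Q.X a) ⟶ (F.obj (N.X i)).obj (Q.X b),
      ∀ a, (F.obj (N.X i)).map (Q.d a (a + 1)) ≫ h (a + 1) a +
        h a (a - 1) ≫ (F.obj (N.X i)).map (Q.d (a - 1) a) = 𝟙 _ := by
    intro i
    obtain ⟨h, hh⟩ := (hrow i).exists_hom
    exact ⟨h, fun a => hh a (a + 1) (a - 1) rfl (by ring)⟩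
  choose h hh using hrow'
  let T := mapBifunctor N Q F (ComplexShape.up ℤ)
  -- With the value zero for `i + j ≠ l`, the inclusions carry no proof of the degree condition.
  let ι : ∀ i j l : ℤ, (F.obj (N.X i)).obj (Q.X j) ⟶ T.X l :=
    ιMapBifunctorOrZero N Q F (ComplexShape.up ℤ)
  have hι : ∀ i j l (e : i + j = l), ιMapBifunctor N Q F (ComplexShape.up ℤ) i j l e = ι i j l :=
    fun i j l e => (ιMapBifunctorOrZero_eq _ _ _ _ _ _ _ e).symm
  -- The sign `(-1)^i` matches that of `1 ⊗ d_Q`: the two cancel in the terms that stay in the row,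
  -- and these add up to the identity.
  let H : ∀ l l' : ℤ, T.X l ⟶ T.X l' := fun l l' =>
    mapBifunctorDesc fun i j _ => i.negOnePow • (h i j (j - 1) ≫ ι i (j - 1) l')
  have ιH : ∀ i j l l' j', i + j = l → j' + 1 = j → ι i j l ≫ H l l' =
      i.negOnePow • (h i j j' ≫ ι i j' l') := by
    rintro i j l l' j' e e'
    obtain rfl : j' = j - 1 := by omega
    rw [← hι i j l e]
    exact ι_mapBifunctorDesc _ _ _ _
  have ιd : ∀ i j l i' j' l', i + j = l → i + 1 = i' → j + 1 = j' → ι i j l ≫ T.d l l' =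
      (F.map (N.d i i')).app (Q.X j) ≫ ι i' j l' +
      i.negOnePow • ((F.obj (N.X i)).map (Q.d j j') ≫ ι i j' l') := by
    intro i j l i' j' l' e ei ej
    rw [← hι i j l e, mapBifunctor.d_eq, Preadditive.comp_add, mapBifunctor.ι_D₁,
      mapBifunctor.ι_D₂, mapBifunctor.d₁_eq' N Q F (ComplexShape.up ℤ) (i₁' := i') (by simpa using ei),
      mapBifunctor.d₂_eq' N Q F (ComplexShape.up ℤ) i (i₂' := j') (by simpa using ej)]
    have : ComplexShape.ε₁ (ComplexShape.up ℤ) (ComplexShape.up ℤ) (ComplexShape.up ℤ) (i, j) = 1 :=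
      rfl
    rw [this, one_smul]
    rfl
  let φ : T ⟶ T := Homotopy.nullHomotopicMap' (fun i j _ => H i j)
  have hφ : ∀ l, φ.f l = T.d l (l + 1) ≫ H (l + 1) l + H l (l - 1) ≫ T.d (l - 1) l := fun l =>
    Homotopy.nullHomotopicMap'_f (k₂ := l - 1) (k₁ := l) (k₀ := l + 1) (by simp) (by simp) _
  -- The error term is the signed commutator of `d_N` with the row homotopies. It is a difference
  -- because the sign of `H` changes from row `i` to row `i + 1`.
  let p : ∀ i j, (F.obj (N.X i)).obj (Q.X j) ⟶ (F.obj (N.X (i + 1))).obj (Q.X (j - 1)) := fun i j =>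
    i.negOnePow • ((F.map (N.d i (i + 1))).app (Q.X j) ≫ h (i + 1) j (j - 1) -
      h i j (j - 1) ≫ (F.map (N.d i (i + 1))).app (Q.X (j - 1)))
  have hp : ∀ i j l, i + j = l → ι i j l ≫ (𝟙 _ - φ.f l) = p i j ≫ ι (i + 1) (j - 1) l := by
    intro i j l e
    have h₂ : (F.obj (N.X i)).map (Q.d j (j + 1)) ≫ h i (j + 1) j ≫ ι i j l =
        ι i j l - h i j (j - 1) ≫ (F.obj (N.X i)).map (Q.d (j - 1) j) ≫ ι i j l := by
      have := congrArg (· ≫ ι i j l) (hh i j)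
      simp only [Preadditive.add_comp, Category.id_comp, Category.assoc] at this
      exact eq_sub_of_add_eq this
    rw [hφ, Preadditive.comp_sub, Preadditive.comp_add, ← Category.assoc, ← Category.assoc,
      ιd i j l (i + 1) (j + 1) _ e rfl rfl, ιH i j _ _ (j - 1) e (by ring), Preadditive.add_comp,
      Linear.units_smul_comp, Linear.units_smul_comp,
      Category.assoc, Category.assoc, Category.assoc, ιH (i + 1) j _ _ (j - 1) (by omega) (by ring),
      ιH i (j + 1) _ _ j (by omega) rfl, ιd i (j - 1) _ (i + 1) j _ (by omega) rfl (by ring),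
      Linear.comp_units_smul, Linear.comp_units_smul, smul_smul,
      h₂, Preadditive.comp_add, Linear.comp_units_smul, smul_add, smul_smul, Int.negOnePow_succ]
    simp only [p, Int.units_mul_self, one_smul, Category.comp_id, Linear.units_smul_comp,
      Preadditive.sub_comp, Category.assoc, Units.neg_smul, smul_sub]
    abel
  have hiso : ∀ l, IsIso (φ.f l) := by
    intro l
    refine isIso_of_locally_nilpotent (S := {s : ℤ × ℤ // s.1 + s.2 = l})
      (Y := fun s => (F.obj (N.X s.1.1)).obj (Q.X s.1.2)) (fun s => ι s.1.1 s.1.2 l) ?_ ?_ (φ.f l)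
      (fun s => ⟨(s.1.1 + 1, s.1.2 - 1), by have := s.2; dsimp only; omega⟩) (fun s => p s.1.1 s.1.2)
      (fun s => hp _ _ _ s.2) ?_
    · intro g
      refine ⟨mapBifunctorDesc fun i j e => g ⟨(i, j), e⟩, fun s => ?_⟩
      rw [← hι _ _ _ s.2]
      exact ι_mapBifunctorDesc _ _ _ _
    · intro φ ψ hs
      refine mapBifunctor.hom_ext fun i j e => ?_
      rw [hι i j l e]
      exact hs ⟨(i, j), e⟩
    · rintro s
      have hK : ∀ K : ℕ, ((fun s : {s : ℤ × ℤ // s.1 + s.2 = l} =>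
          (⟨(s.1.1 + 1, s.1.2 - 1), by have := s.2; dsimp only; omega⟩ :
            {s : ℤ × ℤ // s.1 + s.2 = l}))^[K] s).1 = (s.1.1 + K, s.1.2 - K) := by
        intro K
        induction K with
        | zero => simp
        | succ K ih =>
          rw [Function.iterate_succ_apply']
          dsimp only
          rw [ih]
          push_cast
          exact Prod.ext (by dsimp only; ring) (by dsimp only; ring)
      -- After `K` steps the position is `(i + K, j - K)`: the second index drops below a lower
      -- bound of `Q`, or the first exceeds an upper bound of `N`.
      obtain ⟨b, hb⟩ | ⟨b, hb⟩ := hb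
      · refine ⟨(s.1.2 - b + 1).toNat, ?_⟩
        rw [hK]
        exact (F.obj _).map_isZero (hb _ (by dsimp only; omega))
      · refine ⟨(b - s.1.1 + 1).toNat, ?_⟩
        rw [hK]
        exact (F.flip.obj (Q.X _)).map_isZero (hb _ (by dsimp only; omega))
  have : IsIso φ := HomologicalComplex.Hom.isIso_of_components φ
  exact Contractible.of_isIso (Homotopy.nullHomotopy' (fun i j _ => H i j))

end Total

/-! ## Isotopies are isomorphisms -/

section Isotopy

/-- Two movies without handles and dots, of which the second undoes the first. -/
theorem sameSurface_nil {m n : ℕ} {a b : Diag m n} (s : Step a b) (t : Step b a)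
    (hst : ∀ x y, t.Corr y x ↔ s.Corr x y) (hs : s.handles = []) (hs' : s.dots = [])
    (ht : t.handles = []) (ht' : t.dots = []) (E : Quot a.Adj ≃ Quot b.Adj)
    (hE : ∀ x y, s.Corr x y → E (Quot.mk _ x) = Quot.mk _ y)
    (ha : ∀ x, ∃ x' y, s.Corr x' y ∧ Quot.mk a.Adj x' = Quot.mk a.Adj x)
    (hb : ∀ y, ∃ x y', s.Corr x y' ∧ Quot.mk b.Adj y' = Quot.mk b.Adj y) :
    SameSurface (s.toMovie.comp t.toMovie) Movie.nil := by
  let P : Movie a a := s.toMovie.comp t.toMovie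
  let i₁ : a.Pt → P.Pt := fun x => Sum.inl (Sum.inl x)
  let i₂ : b.Pt → P.Pt := fun y => Sum.inl (Sum.inr y)
  let i₃ : a.Pt → P.Pt := fun x => Sum.inr x
  -- Each strand is sent to the component of `a` on whose sheet it lies, with `E⁻¹` for the middle
  -- frame. The induced map on components is inverse to the inclusion of the first frame.
  let F : P.Pt → Quot a.Adj :=
    Sum.elim (Sum.elim (Quot.mk _) fun y => E.symm (Quot.mk _ y)) (Quot.mk _)
  have hF : ∀ x y, P.Adj x y → F x = F y := by
    rintro ((x | x) | x) ((y | y) | y) h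
    · exact Quot.sound h
    · obtain ⟨z, hz, h⟩ := h
      obtain rfl : x = z := hz
      exact (E.eq_symm_apply).2 (hE _ _ h)
    · obtain ⟨z, hz, h⟩ := h
      exact absurd hz (by intro h; cases h)
    · exact h.elim
    · exact congrArg E.symm (Quot.sound h)
    · obtain ⟨z, hz, h⟩ := h
      obtain rfl : x = z := Sum.inr_injective hz
      exact (E.symm_apply_eq).2 (hE _ _ ((hst _ _).1 h)).symm
    · exact h.elim
    · exact h.elim
    · exact Quot.sound h
  have q₁ : ∀ x y, Quot.mk a.Adj x = Quot.mk a.Adj y → Quot.mk P.Adj (i₁ x) = Quot.mk P.Adj (i₁ y) :=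
    fun x y h => congrArg (Quot.lift (fun x => Quot.mk P.Adj (i₁ x)) fun u v h => Quot.sound h) h
  have q₂ : ∀ x y, Quot.mk b.Adj x = Quot.mk b.Adj y → Quot.mk P.Adj (i₂ x) = Quot.mk P.Adj (i₂ y) :=
    fun x y h => congrArg (Quot.lift (fun x => Quot.mk P.Adj (i₂ x)) fun u v h => Quot.sound h) h
  have q₃ : ∀ x y, Quot.mk a.Adj x = Quot.mk a.Adj y → Quot.mk P.Adj (i₃ x) = Quot.mk P.Adj (i₃ y) :=
    fun x y h => congrArg (Quot.lift (fun x => Quot.mk P.Adj (i₃ x)) fun u v h => Quot.sound h) h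
  have q₁₂ : ∀ x y, s.Corr x y → Quot.mk P.Adj (i₁ x) = Quot.mk P.Adj (i₂ y) :=
    fun x y h => Quot.sound ⟨x, rfl, h⟩
  have q₂₃ : ∀ x y, s.Corr x y → Quot.mk P.Adj (i₂ y) = Quot.mk P.Adj (i₃ x) :=
    fun x y h => Quot.sound ⟨y, rfl, (hst _ _).2 h⟩
  -- Every strand is connected to the first frame. A strand may lack a partner under `Corr`, like
  -- the minimum of a zigzag, so `ha` and `hb` are used to pass first to one in the same component
  -- that has a partner.
  have hinv : ∀ x z, Quot.mk a.Adj z = F x → Quot.mk P.Adj (i₁ z) = Quot.mk P.Adj x := by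
    rintro ((x | y) | x) z hz
    · exact q₁ _ _ hz
    · obtain ⟨x, y', h, hy⟩ := hb y
      refine (q₁ z x ?_).trans ((q₁₂ x y' h).trans (q₂ _ _ hy))
      rw [hz]
      exact (E.symm_apply_eq).2 ((hE _ _ h).trans hy).symm
    · obtain ⟨x', y, h, hx⟩ := ha x
      exact (q₁ z x' (hz.trans hx.symm)).trans ((q₁₂ _ _ h).trans ((q₂₃ _ _ h).trans (q₃ _ _ hx)))
  have hh : P.handles = [] := by
    change ([] ++ s.handles.map _).map _ ++ t.handles.map _ = []
    rw [hs, ht]; rfl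
  have hd : P.dots = [] := by
    change ([] ++ s.dots.map _).map _ ++ t.dots.map _ = []
    rw [hs', ht']; rfl
  refine ⟨⟨Quot.lift F hF, Quot.lift (fun x => Quot.mk _ (i₁ x)) fun u v h => Quot.sound h, ?_, ?_⟩,
    fun x => rfl, fun x => rfl, fun C => ⟨?_, ?_⟩⟩
  · rintro ⟨x⟩
    obtain ⟨z, hz⟩ := Quot.exists_rep (F x)
    change Quot.lift _ _ (F x) = _
    rw [← hz]
    exact hinv x z hz
  · rintro ⟨x⟩
    rfl
  · change P.euler C = _
    rw [Movie.euler, Movie.euler, hh]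
    rfl
  · change P.dotCount C = _
    rw [Movie.dotCount, Movie.dotCount, hd]
    rfl

theorem skip_of_lt {m : ℕ} (i : Fin (m + 1)) (j : Fin m) (h : j.val < i.val) :
    skip i j = j.castAdd 2 := if_pos h

theorem skip_of_le {m : ℕ} (i : Fin (m + 1)) (j : Fin m) (h : i.val ≤ j.val) :
    skip i j = j.addNat 2 := if_neg (by omega)

theorem Diag.top_cup_of_lt {m n : ℕ} (i : Fin (m + 1)) (w : Diag m n) (j : Fin (m + 2))
    (h : j.val < i.val) : (Diag.cup i w).top j = some (w.top ⟨j.val, by omega⟩) := by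
  exact dif_pos h

theorem Diag.top_cup_of_ge {m n : ℕ} (i : Fin (m + 1)) (w : Diag m n) (j : Fin (m + 2))
    (h : i.val + 2 ≤ j.val) :
    (Diag.cup i w).top j = some (w.top ⟨j.val - 2, by omega⟩) := by
  exact (dif_neg (by omega)).trans (dif_pos h)

theorem Diag.top_cup_mid {m n : ℕ} (i : Fin (m + 1)) (w : Diag m n) (j : Fin (m + 2))
    (h : i.val ≤ j.val) (h' : j.val < i.val + 2) : (Diag.cup i w).top j = none := by
  exact (dif_neg (by omega)).trans (dif_neg (by omega))

/-- The involution of `Option (Option X)` which exchanges the two points outside of `X`. -/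
def swapNone {X : Type} : Option (Option X) ≃ Option (Option X) where
  toFun x := x.elim (some none) fun y => y.elim none fun z => some (some z)
  invFun x := x.elim (some none) fun y => y.elim none fun z => some (some z)
  left_inv := by rintro (_ | _ | _) <;> rfl
  right_inv := by rintro (_ | _ | _) <;> rfl

/-- The left side is `Slide.Corr` for a `cupCup` move, unfolded; exchanging two minima swaps their
strands `none` and `some none`. -/
theorem swapNone_eq_iff {X : Type} (x y : Option (Option X)) :
    ((x = none ∧ y = some none) ∨ (x = some none ∧ y = none) ∨
      ∃ r : X, x = some (some r) ∧ y = some (some r)) ↔ swapNone x = y := by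
  rcases x with _ | _ | x <;> rcases y with _ | _ | y <;> simp [swapNone, eq_comm]

/-- The two new minima are adjacent to nothing, so swapping them preserves the adjacency of `cup _
(cup _ w)`. -/
theorem exists_some_swapNone {X : Type} (R : X → X → Prop) (x y : Option (Option X)) :
    (∃ x' y', x = some x' ∧ y = some y' ∧ ∃ u v, x' = some u ∧ y' = some v ∧ R u v) ↔
      ∃ x' y', swapNone x = some x' ∧ swapNone y = some y' ∧
        ∃ u v, x' = some u ∧ y' = some v ∧ R u v := by
  rcases x with _ | _ | x <;> rcases y with _ | _ | y <;> simp [swapNone]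

/-- The components of the diagrams before and after an elementary isotopy correspond to each
other. -/
theorem Slide.exists_equiv {m n : ℕ} {a b : Diag m n} (s : Slide a b) :
    ∃ E : Quot a.Adj ≃ Quot b.Adj, (∀ x y, s.Corr x y → E (Quot.mk _ x) = Quot.mk _ y) ∧
      (∀ x, ∃ x' y, s.Corr x' y ∧ Quot.mk a.Adj x' = Quot.mk a.Adj x) ∧
      (∀ y, ∃ x y', s.Corr x y' ∧ Quot.mk b.Adj y' = Quot.mk b.Adj y) := by
  have of_equiv : ∀ (e : a.Pt ≃ b.Pt), (∀ x y, s.Corr x y ↔ e x = y) →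
      (∀ x y, a.Adj x y ↔ b.Adj (e x) (e y)) →
      ∃ E : Quot a.Adj ≃ Quot b.Adj, (∀ x y, s.Corr x y → E (Quot.mk _ x) = Quot.mk _ y) ∧
      (∀ x, ∃ x' y, s.Corr x' y ∧ Quot.mk a.Adj x' = Quot.mk a.Adj x) ∧
      (∀ y, ∃ x y', s.Corr x y' ∧ Quot.mk b.Adj y' = Quot.mk b.Adj y) := fun e h h' =>
    ⟨Quot.congr e h', fun x y hxy => congrArg _ ((h x y).1 hxy), fun x => ⟨x, e x, (h _ _).2 rfl, rfl⟩,
      fun y => ⟨e.symm y, y, (h _ _).2 (e.apply_symm_apply y), rfl⟩⟩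
  cases s with
  | zigzag i j h =>
    -- `u` is the strand of `b` which the maximum joins to the minimum `none`: top strand `i` if `j
    -- = i + 1`, and top strand `j` if `i = j + 1`. The zigzag only adds `none` to the component of
    -- `u`.
    obtain ⟨u, hu, hn⟩ : ∃ u : b.Pt, (∀ x y : Option b.Pt, (Diag.cap j (.cup i b)).Adj x y →
        (∃ x' y', x = some x' ∧ y = some y' ∧ b.Adj x' y') ∨ (x = none ∧ y = some u) ∨
          (x = some u ∧ y = none)) ∧
        Quot.mk (Diag.cap j (.cup i b)).Adj (some u) = Quot.mk _ none := by
      have adj : ∀ x y : Option b.Pt, (Diag.cup i b).top j.castSucc = x →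
          (Diag.cup i b).top j.succ = y → (Diag.cap j (.cup i b)).Adj x y :=
        fun x y hx hy => Or.inr ⟨hx.symm, hy.symm⟩
      rcases h with h | h
      · have h₁ : (Diag.cup i b).top j.castSucc = none :=
          Diag.top_cup_mid _ _ _ (by simp; omega) (by simp; omega)
        have h₂ : (Diag.cup i b).top j.succ = some (b.top ⟨i.val, by omega⟩) :=
          (Diag.top_cup_of_ge _ _ _ (by simp; omega)).trans
            (congrArg (some ∘ b.top) (Fin.ext (by simp; omega)))
        refine ⟨b.top ⟨i.val, by omega⟩, ?_, (Quot.sound (adj _ _ h₁ h₂)).symm⟩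
        rintro x y (h' | ⟨rfl, rfl⟩)
        · exact Or.inl h'
        · exact Or.inr (Or.inl ⟨h₁, h₂⟩)
      · have h₁ : (Diag.cup i b).top j.castSucc = some (b.top ⟨j.val, by omega⟩) :=
          Diag.top_cup_of_lt _ _ _ (by simp; omega)
        have h₂ : (Diag.cup i b).top j.succ = none :=
          Diag.top_cup_mid _ _ _ (by simp; omega) (by simp; omega)
        refine ⟨b.top ⟨j.val, by omega⟩, ?_, Quot.sound (adj _ _ h₁ h₂)⟩
        rintro x y (h' | ⟨rfl, rfl⟩)
        · exact Or.inl h'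
        · exact Or.inr (Or.inr ⟨h₁, h₂⟩)
    refine ⟨⟨Quot.lift (fun x : Option b.Pt => x.elim (Quot.mk _ u) (Quot.mk _)) ?_,
      Quot.lift (fun x => Quot.mk _ (some x)) ?_, ?_, ?_⟩, ?_, ?_, ?_⟩
    · intro x y hxy
      obtain ⟨x', y', rfl, rfl, h'⟩ | ⟨rfl, rfl⟩ | ⟨rfl, rfl⟩ := hu x y hxy
      · exact Quot.sound h'
      · rfl
      · rfl
    · exact fun x y hxy => Quot.sound (Or.inl ⟨x, y, rfl, rfl, hxy⟩)
    · rintro ⟨_ | x⟩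
      · exact hn
      · rfl
    · rintro ⟨x⟩
      rfl
    · rintro x y rfl
      rfl
    · rintro (_ | x)
      · exact ⟨some u, u, rfl, hn⟩
      · exact ⟨some x, x, rfl, rfl⟩
    · exact fun y => ⟨some y, y, rfl, rfl⟩
  | capCap i j h w =>
    refine of_equiv (Equiv.refl _) (fun x y => Iff.rfl) fun x y => ?_
    have h : i.val ≤ j.val := h
    change ((w.Adj x y ∨ _ ∧ _) ∨ x = w.top (skip _ _) ∧ y = w.top (skip _ _)) ↔
      ((w.Adj x y ∨ _ ∧ _) ∨ x = w.top (skip _ _) ∧ y = w.top (skip _ _))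
    rw [skip_of_lt _ _ (by simp; omega), skip_of_lt _ _ (by simp; omega),
      skip_of_le _ _ (by simp; omega), skip_of_le _ _ (by simp; omega), or_right_comm]
    rfl
  | cupCup i j h w =>
    exact of_equiv swapNone (fun x y => swapNone_eq_iff x y) fun x y => exists_some_swapNone w.Adj x y
  | capCup i j h w =>
    refine of_equiv (Equiv.refl _) (fun x y => Iff.rfl) fun x y => ?_
    have h : i.val ≤ j.val := h
    constructor
    · rintro (⟨x', y', rfl, rfl, hxy⟩ | ⟨rfl, rfl⟩)
      · exact ⟨x', y', rfl, rfl, Or.inl hxy⟩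
      · exact ⟨_, _, Diag.top_cup_of_lt _ _ _ (by simp; omega),
          Diag.top_cup_of_lt _ _ _ (by simp; omega), Or.inr ⟨rfl, rfl⟩⟩
    · rintro ⟨x', y', rfl, rfl, hxy | ⟨rfl, rfl⟩⟩
      · exact Or.inl ⟨x', y', rfl, rfl, hxy⟩
      · exact Or.inr ⟨(Diag.top_cup_of_lt _ _ _ (by simp; omega)).symm,
          (Diag.top_cup_of_lt _ _ _ (by simp; omega)).symm⟩
  | cupCap i j h w =>
    refine of_equiv (Equiv.refl _) (fun x y => Iff.rfl) fun x y => ?_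
    have h : i.val ≤ j.val := h
    constructor
    · rintro (⟨x', y', rfl, rfl, hxy⟩ | ⟨rfl, rfl⟩)
      · exact ⟨x', y', rfl, rfl, Or.inl hxy⟩
      · exact ⟨_, _, Diag.top_cup_of_ge _ _ _ (by simp; omega),
          Diag.top_cup_of_ge _ _ _ (by simp; omega), Or.inr ⟨rfl, rfl⟩⟩
    · rintro ⟨x', y', rfl, rfl, hxy | ⟨rfl, rfl⟩⟩
      · exact Or.inl ⟨x', y', rfl, rfl, hxy⟩
      · exact Or.inr ⟨(Diag.top_cup_of_ge _ _ _ (by simp; omega)).symm,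
          (Diag.top_cup_of_ge _ _ _ (by simp; omega)).symm⟩

/-- An elementary isotopy is an isomorphism. -/
theorem Slide.toCob_comp_toCob {m n : ℕ} {a b : Diag m n} (s : Slide a b) :
    (Step.slide s).toMovie.toCob ≫ (Step.unslide s).toMovie.toCob = 𝟙 (Cob.of a) := by
  obtain ⟨E, hE, ha, hb⟩ := s.exists_equiv
  refine (Movie.comp_toCob _ _).symm.trans ((CategoryTheory.Quotient.sound (cobRel m n)
    (CobRel.surface _ Movie.nil (sameSurface_nil (.slide s) (.unslide s) (fun x y => Iff.rfl) rfl rfl rfl rfl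
      E hE
      ha hb))).trans ?_)
  exact (congrArg (Cob.cls m n).map ((Free.embedding _ (Diag m n)).map_id a)).trans
    ((Cob.cls m n).map_id _)

theorem Slide.toCob_comp_toCob' {m n : ℕ} {a b : Diag m n} (s : Slide a b) :
    (Step.unslide s).toMovie.toCob ≫ (Step.slide s).toMovie.toCob = 𝟙 (Cob.of b) := by
  obtain ⟨E, hE, ha, hb⟩ := s.exists_equiv
  refine (Movie.comp_toCob _ _).symm.trans ((CategoryTheory.Quotient.sound (cobRel m n)
    (CobRel.surface _ Movie.nil (sameSurface_nil (.unslide s) (.slide s) (fun x y => Iff.rfl) rfl rfl rfl rfl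
      E.symm
      (fun x y h => (E.symm_apply_eq).2 (hE _ _ h).symm) (fun x => ?_) (fun x => ?_)))).trans ?_)
  · obtain ⟨x', y', h, h'⟩ := hb x
    exact ⟨y', x', h, h'⟩
  · obtain ⟨x', y', h, h'⟩ := ha x
    exact ⟨y', x', h, h'⟩
  exact (congrArg (Cob.cls m n).map ((Free.embedding _ (Diag m n)).map_id b)).trans
    ((Cob.cls m n).map_id _)

end Isotopy

/-! ## Reduction of diagrams -/

section Factors

/-- The homogeneous endomorphisms of degree zero of `b` which are sums of homogeneous maps that
factor through `w`. -/
noncomputable def throughIdeal {m n : ℕ} (b w : Diag m n) : AddSubgroup (Cob.of b ⟶ Cob.of b) :=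
  AddSubgroup.closure {h | ∃ (d : ℤ) (f : Cob.of b ⟶ Cob.of w) (g : Cob.of w ⟶ Cob.of b),
    f ∈ Cob.homogeneous b w d ∧ g ∈ Cob.homogeneous w b (-d) ∧ h = f ≫ g}

/-- The identity of `b` is a sum of homogeneous maps which factor through `w`. -/
def Factors {m n : ℕ} (b w : Diag m n) : Prop := 𝟙 (Cob.of b) ∈ throughIdeal b w

theorem comp_mem_throughIdeal {m n : ℕ} {b w : Diag m n} {d : ℤ} {f : Cob.of b ⟶ Cob.of w}
    {g : Cob.of w ⟶ Cob.of b} (hf : f ∈ Cob.homogeneous b w d)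
    (hg : g ∈ Cob.homogeneous w b (-d)) : f ≫ g ∈ throughIdeal b w :=
  AddSubgroup.subset_closure ⟨d, f, g, hf, hg, rfl⟩

theorem Factors.refl {m n : ℕ} (b : Diag m n) : Factors b b := by
  have := comp_mem_throughIdeal (Cob.id_mem b) (by simpa using Cob.id_mem b)
  rwa [Category.comp_id] at this

/-- The expansion of the identity of `b` is inserted in the middle of each `f ≫ g`. Degrees `d` and
`e` of the first halves add, as do `-d` and `-e` of the second halves, so they stay opposite. -/
theorem Factors.trans {m n : ℕ} {a b c : Diag m n} (hab : Factors a b) (hbc : Factors b c) :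
    Factors a c := by
  have key : ∀ h ∈ throughIdeal b c, ∀ (d : ℤ) (f : Cob.of a ⟶ Cob.of b)
      (g : Cob.of b ⟶ Cob.of a), f ∈ Cob.homogeneous a b d → g ∈ Cob.homogeneous b a (-d) →
      f ≫ h ≫ g ∈ throughIdeal a c := by
    intro h hh d f g hf hg
    induction hh using AddSubgroup.closure_induction with
    | mem h hh =>
      obtain ⟨e, u, v, hu, hv, rfl⟩ := hh
      have h₁ := Cob.comp_mem hf hu
      have h₂ := Cob.comp_mem hv hg
      rw [← neg_add_rev] at h₂
      have := comp_mem_throughIdeal h₁ (by simpa [add_comm] using h₂)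
      simpa only [Category.assoc] using this
    | zero => rw [zero_comp, comp_zero]; exact zero_mem _
    | add x y _ _ hx hy =>
      rw [Preadditive.add_comp, Preadditive.comp_add]; exact add_mem hx hy
    | neg x _ hx => rw [Preadditive.neg_comp, Preadditive.comp_neg]; exact neg_mem hx
  suffices throughIdeal a b ≤ throughIdeal a c from this hab
  refine (AddSubgroup.closure_le _).2 ?_
  rintro _ ⟨d, f, g, hf, hg, rfl⟩
  simpa using key _ hbc d f g hf hg

theorem Factors.stackL {m k n : ℕ} (c : Diag m k) {a b : Diag k n} (h : Factors a b) :
    Factors (c.stack a) (c.stack b) := by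
  suffices throughIdeal a b ≤
      (throughIdeal (c.stack a) (c.stack b)).comap (Cob.stackL c).toAddMonoidHom by
    exact (congrArg (· ∈ throughIdeal _ _) (Cob.stackL_id c a)).mp (this h)
  refine (AddSubgroup.closure_le _).2 ?_
  rintro _ ⟨d, f, g, hf, hg, rfl⟩
  refine AddSubgroup.mem_comap.2 ?_
  change Cob.stackL c (f ≫ g) ∈ _
  rw [Cob.stackL_comp]
  exact comp_mem_throughIdeal (Cob.stackL_mem c hf) (Cob.stackL_mem c hg)

/-- Stacking a single maximum on `a` unfolds to `cap i a`. -/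
theorem Factors.cap {m n : ℕ} (i : Fin (m + 1)) {a b : Diag (m + 2) n} (h : Factors a b) :
    Factors (.cap i a) (.cap i b) :=
  h.stackL (.cap i (.nil (m + 2)))

theorem Factors.cup {m n : ℕ} (i : Fin (m + 1)) {a b : Diag m n} (h : Factors a b) :
    Factors (.cup i a) (.cup i b) :=
  h.stackL (.cup i (.nil m))

theorem Movie.toCob_mem {m n : ℕ} {a b : Diag m n} (p : Movie a b) {d : ℤ} (h : p.deg = d) :
    p.toCob ∈ Cob.homogeneous a b d :=
  AddSubgroup.subset_closure ⟨0, p, by simpa using h, by simp⟩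

theorem Slide.factors {m n : ℕ} {a b : Diag m n} (s : Slide a b) : Factors a b := by
  have := comp_mem_throughIdeal (d := 0) (Movie.toCob_mem (Step.slide s).toMovie rfl)
    (Movie.toCob_mem (Step.unslide s).toMovie rfl)
  rwa [s.toCob_comp_toCob] at this

theorem Slide.factors' {m n : ℕ} {a b : Diag m n} (s : Slide a b) : Factors b a := by
  have := comp_mem_throughIdeal (d := 0) (Movie.toCob_mem (Step.unslide s).toMovie rfl)
    (Movie.toCob_mem (Step.slide s).toMovie rfl)
  rwa [s.toCob_comp_toCob'] at this

/-- Isotopic diagrams factor through each other. -/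
theorem Isotopic.factors {m n : ℕ} {a b : Diag m n} (h : Isotopic a b) :
    Factors a b ∧ Factors b a := by
  induction h with
  | slide s => exact ⟨s.factors, s.factors'⟩
  | cap i _ ih => exact ⟨ih.1.cap i, ih.2.cap i⟩
  | cup i _ ih => exact ⟨ih.1.cup i, ih.2.cup i⟩
  | refl a => exact ⟨.refl a, .refl a⟩
  | symm _ ih => exact ih.symm
  | trans _ _ ih ih' => exact ⟨ih.1.trans ih'.1, ih'.2.trans ih.2⟩

/-- Neck-cutting removes a circle. -/
theorem factors_circle {m n : ℕ} (i : Fin (m + 1)) (w : Diag m n) :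
    Factors (.cap i (.cup i w)) w := by
  have h : 𝟙 (Cob.of (.cap i (.cup i w))) =
      (deathOf i w).toCob ≫ ((birthOf i w).comp (circleDot i w)).toCob +
        ((circleDot i w).comp (deathOf i w)).toCob ≫ (birthOf i w).toCob := by
    rw [← Movie.comp_toCob, ← Movie.comp_toCob]
    refine ((Cob.cls m n).map_id _).symm.trans
      ((CategoryTheory.Quotient.sound (cobRel m n) (CobRel.neck i w)).trans ?_)
    exact (Cob.cls m n).map_add
  refine (congrArg (· ∈ throughIdeal _ w) h).mpr (add_mem ?_ ?_)
  -- A birth or death has degree `-1` and a dot has degree `2`. The two summands pass through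
  -- different shifts of `w`, hence the free degree `d` in `throughIdeal`.
  · exact comp_mem_throughIdeal (d := -1) (Movie.toCob_mem _ rfl) (Movie.toCob_mem _ rfl)
  · exact comp_mem_throughIdeal (d := 1) (Movie.toCob_mem _ rfl) (Movie.toCob_mem _ rfl)

end Factors

/-! ### Pushing maxima to the bottom -/

section NormalForm

/-- Diagrams which end with a turnback. -/
inductive EndsWithTurnback {n : ℕ} : {m : ℕ} → Diag m n → Prop
  | base {m : ℕ} {w : Diag m n} (h : IsTurnback w) : EndsWithTurnback w
  | cap {m : ℕ} (i : Fin (m + 1)) {w : Diag (m + 2) n} (h : EndsWithTurnback w) :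
      EndsWithTurnback (.cap i w)
  | cup {m : ℕ} (i : Fin (m + 1)) {w : Diag m n} (h : EndsWithTurnback w) :
      EndsWithTurnback (.cup i w)

/-- Diagrams without maxima. -/
inductive CupOnly {n : ℕ} : {m : ℕ} → Diag m n → Prop
  | nil : CupOnly (.nil n)
  | cup {m : ℕ} (i : Fin (m + 1)) {w : Diag m n} (h : CupOnly w) : CupOnly (.cup i w)

/-- Each minimum adds two top points. This excludes the case without turnback when there are fewer
top points than bottom points. -/
theorem CupOnly.le {m n : ℕ} {w : Diag m n} (h : CupOnly w) : n ≤ m := by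
  induction h with
  | nil => exact le_rfl
  | cup i _ ih => omega

theorem EndsWithTurnback.stack {m k n : ℕ} (a : Diag m k) {w : Diag k n}
    (h : EndsWithTurnback w) : EndsWithTurnback (a.stack w) := by
  induction a with
  | nil => exact h
  | cap i a ih => exact .cap i (ih h)
  | cup i a ih => exact .cup i (ih h)

/-- A maximum placed on a word of minima moves down until it meets a minimum that absorbs it, or
reaches the bottom as a turnback. The equation `e` leaves the index `k` free for the induction. -/
theorem CupOnly.exists_cap {k n : ℕ} {w : Diag k n} (hw : CupOnly w) :
    ∀ (l : ℕ) (e : k = l + 2) (i : Fin (l + 1)), ∃ w' : Diag l n,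
      (EndsWithTurnback w' ∨ CupOnly w') ∧ Factors (.cap i (e ▸ w)) w' := by
  induction hw with
  | nil =>
    rintro l rfl i
    exact ⟨_, Or.inl (.base (.mk i)), .refl _⟩
  | @cup k j w hw ih =>
    intro l e i
    obtain rfl : k = l := by omega
    -- Equal positions form a circle, neighbouring ones a zigzag; otherwise the critical points are
    -- at least two positions apart and exchange heights.
    by_cases h₁ : i = j
    · subst h₁
      exact ⟨w, Or.inr hw, factors_circle i w⟩
    by_cases h₂ : i.val = j.val + 1 ∨ j.val = i.val + 1
    · exact ⟨w, Or.inr hw, (Slide.zigzag j i h₂ w).factors⟩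
    have h₃ : i.val ≠ j.val := fun h => h₁ (Fin.ext h)
    obtain ⟨l, rfl⟩ : ∃ l, k = l + 2 := ⟨k - 2, by omega⟩
    rcases lt_or_gt_of_ne h₃ with h | h
    -- Once below, the maximum removes two points left of the minimum, whose position drops to `j -
    -- 2`. In the mirrored case the position of the maximum drops to `i - 2`.
    · obtain ⟨w', hw', hf⟩ := ih l rfl ⟨i.val, by omega⟩
      have s := Slide.capCup (m := l) ⟨i.val, by omega⟩ ⟨j.val - 2, by omega⟩
        (Fin.mk_le_mk.2 (by omega)) w
      have hi : Fin.castAdd 2 (⟨i.val, by omega⟩ : Fin (l + 1)) = i := rfl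
      have hj : Fin.addNat (⟨j.val - 2, by omega⟩ : Fin (l + 1)) 2 = j := Fin.ext (by simp; omega)
      rw [hi, hj] at s
      refine ⟨.cup ⟨j.val - 2, by omega⟩ w', ?_, s.factors.trans (hf.cup _)⟩
      exact hw'.imp (.cup _) (.cup _)
    · obtain ⟨w', hw', hf⟩ := ih l rfl ⟨i.val - 2, by omega⟩
      have s := Slide.cupCap (m := l) ⟨j.val, by omega⟩ ⟨i.val - 2, by omega⟩
        (Fin.mk_le_mk.2 (by omega)) w
      have hj : Fin.castAdd 2 (⟨j.val, by omega⟩ : Fin (l + 1)) = j := rfl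
      have hi : Fin.addNat (⟨i.val - 2, by omega⟩ : Fin (l + 1)) 2 = i := Fin.ext (by simp; omega)
      rw [hi, hj] at s
      refine ⟨.cup ⟨j.val, by omega⟩ w', ?_, s.factors.trans (hf.cup _)⟩
      exact hw'.imp (.cup _) (.cup _)

/-- The word is built from the bottom up. Each new minimum preserves both alternatives; a new
maximum preserves the first, and `CupOnly.exists_cap` handles the second. -/
theorem exists_factors {m n : ℕ} (b : Diag m n) :
    ∃ w : Diag m n, (EndsWithTurnback w ∨ CupOnly w) ∧ Factors b w := by
  induction b with
  | nil n => exact ⟨_, Or.inr .nil, .refl _⟩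
  | cup i b ih =>
    obtain ⟨w, hw, hf⟩ := ih
    exact ⟨.cup i w, hw.imp (.cup i) (.cup i), hf.cup i⟩
  | cap i b ih =>
    obtain ⟨w, hw | hw, hf⟩ := ih
    · exact ⟨.cap i w, Or.inl (.cap i hw), hf.cap i⟩
    · obtain ⟨w', hw', hf'⟩ := hw.exists_cap _ rfl i
      exact ⟨w', hw', (hf.cap i).trans hf'⟩

/-- A diagram of through-degree less than `n` factors through a diagram which ends with a
turnback. -/
theorem exists_endsWithTurnback {m n : ℕ} (c : Diag m n) (hc : c.throughDegree < n) :
    ∃ w : Diag m n, EndsWithTurnback w ∧ Factors c w := by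
  -- The infimum is attained, as `c` is itself stacked below the identity diagram.
  obtain ⟨a, b, hab⟩ : c.throughDegree ∈
      {k | ∃ (a : Diag m k) (b : Diag k n), Isotopic c (a.stack b)} :=
    Nat.sInf_mem ⟨m, .nil m, c, .refl c⟩
  obtain ⟨w, hw | hw, hf⟩ := exists_factors b
  · exact ⟨a.stack w, hw.stack a, hab.factors.1.trans (hf.stackL a)⟩
  · exact absurd hw.le (by omega)

end NormalForm

/-! ## Rows of the tensor product -/

/-! ### Natural transformations applied to matrices and complexes -/

section MapMat

universe v₁ u₁ u₂
variable {A : Type u₁} {B : Type u₂} [Category.{v₁} A] [Category.{v₁} B]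
  [Preadditive B]

open scoped Classical in
/-- The diagonal matrix with entries given by a natural transformation. -/
noncomputable def diagMat {G G' : A ⥤ B} (α : G ⟶ G') (M : Mat_ A) (i j : M.ι) :
    G.obj (M.X i) ⟶ G'.obj (M.X j) :=
  if h : i = j then α.app (M.X i) ≫ eqToHom (congrArg (fun j => G'.obj (M.X j)) h) else 0

theorem diagMat_self {G G' : A ⥤ B} (α : G ⟶ G') (M : Mat_ A) (i : M.ι) :
    diagMat α M i i = α.app (M.X i) := by
  rw [diagMat, dif_pos rfl, eqToHom_refl, Category.comp_id]

theorem diagMat_of_ne {G G' : A ⥤ B} (α : G ⟶ G') (M : Mat_ A) {i j : M.ι} (h : i ≠ j) :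
    diagMat α M i j = 0 := dif_neg h

theorem sum_comp_diagMat {G G' : A ⥤ B} (α : G ⟶ G') (M : Mat_ A) {X : B}
    (f : ∀ j : M.ι, X ⟶ G.obj (M.X j)) (k : M.ι) :
    ∑ j, f j ≫ diagMat α M j k = f k ≫ α.app (M.X k) := by
  rw [Finset.sum_eq_single k, diagMat_self]
  · exact fun j _ hj => by rw [diagMat_of_ne _ _ hj, comp_zero]
  · exact fun h => absurd (Finset.mem_univ k) h

theorem sum_diagMat_comp {G G' : A ⥤ B} (α : G ⟶ G') (M : Mat_ A) {X : B}
    (f : ∀ j : M.ι, G'.obj (M.X j) ⟶ X) (i : M.ι) :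
    ∑ j, diagMat α M i j ≫ f j = α.app (M.X i) ≫ f i := by
  rw [Finset.sum_eq_single i, diagMat_self]
  · exact fun j _ hj => by rw [diagMat_of_ne _ _ (Ne.symm hj), zero_comp]
  · exact fun h => absurd (Finset.mem_univ i) h

variable [Preadditive A]

/-- A natural transformation of additive functors gives diagonal matrices. -/
noncomputable def mapMatNat {G G' : A ⥤ B} [G.Additive] [G'.Additive] (α : G ⟶ G') :
    G.mapMat_ ⟶ G'.mapMat_ where
  app M := diagMat α M
  naturality M M' f := funext fun i => funext fun k =>
    (sum_comp_diagMat α M' (fun j => G.map (f i j)) k).trans ((α.naturality (f i k)).trans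
      (sum_diagMat_comp α M (fun j => G'.map (f j k)) i).symm)

theorem mapMatNat_id (G : A ⥤ B) [G.Additive] : mapMatNat (𝟙 G) = 𝟙 _ := by
  refine NatTrans.ext (funext fun M => funext fun (i : M.ι) => funext fun (j : M.ι) => ?_)
  change diagMat (𝟙 G) M i j = (𝟙 (G.mapMat_.obj M) : G.mapMat_.obj M ⟶ G.mapMat_.obj M) i j
  by_cases h : i = j
  · subst h
    exact (diagMat_self _ _ _).trans (Mat_.id_apply_self (G.mapMat_.obj M) i).symm
  · exact (diagMat_of_ne _ _ h).trans (Mat_.id_apply_of_ne (G.mapMat_.obj M) i j h).symm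

theorem mapMatNat_comp {G G' G'' : A ⥤ B} [G.Additive] [G'.Additive] [G''.Additive] (α : G ⟶ G')
    (β : G' ⟶ G'') : mapMatNat (α ≫ β) = mapMatNat α ≫ mapMatNat β := by
  refine NatTrans.ext (funext fun M => funext fun (i : M.ι) => funext fun (k : M.ι) => ?_)
  refine Eq.trans ?_ (sum_diagMat_comp α M (fun j => diagMat β M j k) i).symm
  change diagMat (α ≫ β) M i k = _
  by_cases h : i = k
  · subst h
    rw [diagMat_self, diagMat_self]
    rfl
  · rw [diagMat_of_ne _ _ h, diagMat_of_ne _ _ h, comp_zero]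

theorem mapMatNat_add {G G' : A ⥤ B} [G.Additive] [G'.Additive] (α β : G ⟶ G') :
    mapMatNat (α + β) = mapMatNat α + mapMatNat β := by
  refine NatTrans.ext (funext fun M => funext fun (i : M.ι) => funext fun (k : M.ι) => ?_)
  change diagMat (α + β) M i k = diagMat α M i k + diagMat β M i k
  by_cases h : i = k
  · subst h
    rw [diagMat_self, diagMat_self, diagMat_self]
    rfl
  · rw [diagMat_of_ne _ _ h, diagMat_of_ne _ _ h, diagMat_of_ne _ _ h, add_zero]

instance mapMat_additive (G : A ⥤ B) [G.Additive] : G.mapMat_.Additive where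
  map_add {_ _ f g} := funext fun i => funext fun j => G.map_add (f := f i j) (g := g i j)

/-- The chain map given by a natural transformation. -/
noncomputable def mapMatChain {G G' : A ⥤ B} [G.Additive] [G'.Additive] (α : G ⟶ G')
    (Q : CochainComplex (Mat_ A) ℤ) :
    (G.mapMat_.mapHomologicalComplex (ComplexShape.up ℤ)).obj Q ⟶
      (G'.mapMat_.mapHomologicalComplex (ComplexShape.up ℤ)).obj Q :=
  (NatTrans.mapHomologicalComplex (mapMatNat α) (ComplexShape.up ℤ)).app Q

theorem mapMatChain_id (G : A ⥤ B) [G.Additive] (Q : CochainComplex (Mat_ A) ℤ) :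
    mapMatChain (𝟙 G) Q = 𝟙 _ := by
  ext : 1
  exact congrArg (fun β => NatTrans.app β _) (mapMatNat_id G)

theorem mapMatChain_comp {G G' G'' : A ⥤ B} [G.Additive] [G'.Additive] [G''.Additive]
    (α : G ⟶ G') (β : G' ⟶ G'') (Q : CochainComplex (Mat_ A) ℤ) :
    mapMatChain (α ≫ β) Q = mapMatChain α Q ≫ mapMatChain β Q := by
  ext : 1
  exact congrArg (fun β => NatTrans.app β _) (mapMatNat_comp α β)

theorem mapMatChain_add {G G' : A ⥤ B} [G.Additive] [G'.Additive] (α β : G ⟶ G')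
    (Q : CochainComplex (Mat_ A) ℤ) :
    mapMatChain (α + β) Q = mapMatChain α Q + mapMatChain β Q := by
  ext : 1
  exact congrArg (fun β => NatTrans.app β _) (mapMatNat_add α β)

theorem Contractible.of_natRetract {G G' : A ⥤ B} [G.Additive] [G'.Additive] (α : G ⟶ G')
    (β : G' ⟶ G) (h : α ≫ β = 𝟙 G) {Q : CochainComplex (Mat_ A) ℤ}
    (hQ : Contractible ((G'.mapMat_.mapHomologicalComplex (ComplexShape.up ℤ)).obj Q)) :
    Contractible ((G.mapMat_.mapHomologicalComplex (ComplexShape.up ℤ)).obj Q) :=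
  hQ.of_retract (mapMatChain α Q) (mapMatChain β Q)
    (by rw [← mapMatChain_comp, h, mapMatChain_id])

end MapMat

/-! ### Rows given by a single diagram -/

section Row

/-- The complex `x ⊗ Q`, for a shifted diagram `x` and a complex `Q`. -/
noncomputable abbrev rowComplex {k n m : ℕ} (x : GCob k n) (Q : CochainComplex (BN n m) ℤ) :
    CochainComplex (BN k m) ℤ :=
  (((GCob.tensor k n m).obj x).mapMat_.mapHomologicalComplex (ComplexShape.up ℤ)).obj Q

/-- If the identity of `c` factors through `w` and all shifts of `w` kill `Q`, so do all shifts of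
`c`. -/
theorem Factors.contractible {k n m : ℕ} {c w : Diag k n} (h : Factors c w)
    {Q : CochainComplex (BN n m) ℤ} (hw : ∀ s, Contractible (rowComplex ⟨s, w⟩ Q)) (s : ℤ) :
    Contractible (rowComplex ⟨s, c⟩ Q) := by
  apply contractible_of_mem_closure
  -- Degree zero is proved along with the claim, since `f` must be a morphism of `GCob` before it
  -- can act on `Q`.
  have key : ∀ f ∈ throughIdeal c w, ∃ hf : f ∈ Cob.homogeneous c c (s - s),
      mapMatChain ((GCob.tensor k n m).map (show (⟨s, c⟩ : GCob k n) ⟶ ⟨s, c⟩ from ⟨f, hf⟩)) Q ∈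
        AddSubgroup.closure {f | ∃ (L : CochainComplex (BN k m) ℤ)
          (g : rowComplex (m := m) ⟨s, c⟩ Q ⟶ L) (g' : L ⟶ rowComplex ⟨s, c⟩ Q),
          Contractible L ∧ f = g ≫ g'} := by
    have hmap : ∀ {x y : GCob k n} (u v : x ⟶ y),
        mapMatChain ((GCob.tensor k n m).map (u + v)) Q =
        mapMatChain ((GCob.tensor k n m).map u) Q + mapMatChain ((GCob.tensor k n m).map v) Q := by
      intro x y u v
      rw [Functor.map_add, mapMatChain_add]
    let Ψ : ((⟨s, c⟩ : GCob k n) ⟶ ⟨s, c⟩) →+ (rowComplex (m := m) ⟨s, c⟩ Q ⟶ rowComplex ⟨s, c⟩ Q) :=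
      AddMonoidHom.mk' (fun u => mapMatChain ((GCob.tensor k n m).map u) Q) hmap
    intro f hf
    induction hf using AddSubgroup.closure_induction with
    | mem f hf =>
      obtain ⟨d, f, g, hf, hg, rfl⟩ := hf
      refine ⟨?_, AddSubgroup.subset_closure ?_⟩
      · rw [sub_self, ← add_neg_cancel d]
        exact Cob.comp_mem hf hg
      -- The shift `s - d` of `w` makes both halves morphisms of degree zero; this is why all shifts
      -- of `w` are needed.
      · let u : (⟨s, c⟩ : GCob k n) ⟶ ⟨s - d, w⟩ := ⟨f, by
          change f ∈ Cob.homogeneous _ _ (s - (s - d)); rwa [sub_sub_cancel]⟩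
        let v : (⟨s - d, w⟩ : GCob k n) ⟶ ⟨s, c⟩ := ⟨g, by
          change g ∈ Cob.homogeneous _ _ (s - d - s)
          rwa [show s - d - s = -d by ring]⟩
        refine ⟨_, mapMatChain ((GCob.tensor k n m).map u) Q,
          mapMatChain ((GCob.tensor k n m).map v) Q, hw (s - d), ?_⟩
        rw [← mapMatChain_comp, ← Functor.map_comp]
        rfl
    | zero => exact ⟨zero_mem _, (congrArg (· ∈ AddSubgroup.closure _) Ψ.map_zero).mpr (zero_mem _)⟩
    | add f g _ _ hf hg =>
      obtain ⟨hf, hf'⟩ := hf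
      obtain ⟨hg, hg'⟩ := hg
      refine ⟨add_mem hf hg, ?_⟩
      have := add_mem hf' hg'
      rwa [← hmap] at this
    | neg f _ hf =>
      obtain ⟨hf, hf'⟩ := hf
      refine ⟨neg_mem hf, ?_⟩
      have := neg_mem hf'
      exact (congrArg (· ∈ AddSubgroup.closure _) (Ψ.map_neg _)).mpr this
  obtain ⟨hf, h'⟩ := key _ h
  refine (congrArg (· ∈ AddSubgroup.closure _) ?_).mp h'
  refine Eq.trans ?_ (mapMatChain_id _ Q)
  exact congrArg (fun u => mapMatChain u Q) ((GCob.tensor k n m).map_id _)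

/-- Both sides have definitionally the same ends. This peels one layer off the functor `c ⊗ -`, for
inductions over diagrams. -/
theorem Movie.stackL_cap {m k n : ℕ} (i : Fin (m + 1)) (c : Diag (m + 2) k) {a b : Diag k n}
    (p : Movie a b) : p.stackL (.cap i c) = (p.stackL c).stackL (.cap i (.nil _)) := by
  induction p with
  | nil => rfl
  | cons p s ih => exact congrArg (fun q => Movie.cons q _) ih

theorem Movie.stackL_cup {m k n : ℕ} (i : Fin (m + 1)) (c : Diag m k) {a b : Diag k n}
    (p : Movie a b) : p.stackL (.cup i c) = (p.stackL c).stackL (.cup i (.nil _)) := by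
  induction p with
  | nil => rfl
  | cons p s ih => exact congrArg (fun q => Movie.cons q _) ih

theorem Movie.stackL_nil {k n : ℕ} {a b : Diag k n} (p : Movie a b) :
    p.stackL (.nil k) = p := by
  induction p with
  | nil => rfl
  | cons p s ih => exact congrArg (fun q => Movie.cons q _) ih

theorem Cob.linearMap_ext {m n m' n' : ℕ} {a b : Diag m n} {a' b' : Diag m' n'}
    {S T : (Cob.of a ⟶ Cob.of b) →ₗ[Polynomial ℤ] (Cob.of a' ⟶ Cob.of b')}
    (h : ∀ p : Movie a b, S p.toCob = T p.toCob) (f : Cob.of a ⟶ Cob.of b) : S f = T f := by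
  induction f using Cob.hom_induction with
  | zero => rw [map_zero, map_zero]
  | add f g hf hg => rw [map_add, map_add, hf, hg]
  | movie r p => rw [map_smul, map_smul, h]

theorem Cob.stackL_cap {m k n : ℕ} (i : Fin (m + 1)) (c : Diag (m + 2) k) {a b : Diag k n}
    (f : Cob.of a ⟶ Cob.of b) :
    Cob.stackL (.cap i c) f = Cob.stackL (.cap i (.nil _)) (Cob.stackL c f) := by
  refine Cob.linearMap_ext (S := Cob.stackL (.cap i c))
    (T := (Cob.stackL (.cap i (.nil _))).comp (Cob.stackL c)) (fun p => ?_) f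
  exact (Cob.stackL_toCob _ p).trans ((congrArg Movie.toCob (Movie.stackL_cap i c p)).trans
    ((Cob.stackL_toCob _ _).symm.trans (congrArg (Cob.stackL _) (Cob.stackL_toCob c p).symm)))

theorem Cob.stackL_cup {m k n : ℕ} (i : Fin (m + 1)) (c : Diag m k) {a b : Diag k n}
    (f : Cob.of a ⟶ Cob.of b) :
    Cob.stackL (.cup i c) f = Cob.stackL (.cup i (.nil _)) (Cob.stackL c f) := by
  refine Cob.linearMap_ext (S := Cob.stackL (.cup i c))
    (T := (Cob.stackL (.cup i (.nil _))).comp (Cob.stackL c)) (fun p => ?_) f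
  exact (Cob.stackL_toCob _ p).trans ((congrArg Movie.toCob (Movie.stackL_cup i c p)).trans
    ((Cob.stackL_toCob _ _).symm.trans (congrArg (Cob.stackL _) (Cob.stackL_toCob c p).symm)))

theorem Cob.stackL_nil {k n : ℕ} {a b : Diag k n} (f : Cob.of a ⟶ Cob.of b) :
    Cob.stackL (.nil k) f = f := by
  refine Cob.linearMap_ext (S := Cob.stackL (.nil k)) (T := LinearMap.id) (fun p => ?_) f
  rw [Cob.stackL_toCob, Movie.stackL_nil]
  rfl

/-- If `e ⊗ c` is `c'`, then a complex killed by `c` is killed by `c'`. -/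
theorem contractible_row_of_stack {l k n m : ℕ} (e : Diag l k) (c : Diag k n) (c' : Diag l n)
    {s t u : ℤ} (hu : u = s + t) (hc : ∀ d : Diag n m, c'.stack d = e.stack (c.stack d))
    (hf : ∀ {a b : Diag n m} (f : Cob.of a ⟶ Cob.of b),
      Cob.stackL c' f ≫ eqToHom (congrArg Cob.of (hc b)) =
        eqToHom (congrArg Cob.of (hc a)) ≫ Cob.stackL e (Cob.stackL c f))
    {Q : CochainComplex (BN n m) ℤ} (h : Contractible (rowComplex ⟨t, c⟩ Q)) :
    Contractible (rowComplex ⟨u, c'⟩ Q) := by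
  have mem : ∀ {a b : Diag l m} (h : a = b) {s t : ℤ}, s = t →
      eqToHom (congrArg Cob.of h) ∈ Cob.homogeneous a b (s - t) := by
    rintro a _ rfl s _ rfl
    rw [sub_self]
    exact Cob.id_mem a
  let G : GCob n m ⥤ GCob l m := (GCob.tensor k n m).obj ⟨t, c⟩ ⋙ (GCob.tensor l k m).obj ⟨s, e⟩
  have h' : Contractible ((G.mapMat_.mapHomologicalComplex (ComplexShape.up ℤ)).obj Q) :=
    h.map ((GCob.tensor l k m).obj ⟨s, e⟩).mapMat_
  -- The identifications `hc` form a natural isomorphism from tensoring with `c'` to tensoring with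
  -- `c` and then with `e`; they have degree zero because `u = s + t`.
  refine Contractible.of_natRetract (G := (GCob.tensor l n m).obj ⟨u, c'⟩) (G' := G)
    { app := fun y => ⟨eqToHom (congrArg Cob.of (hc y.diag)), mem (hc y.diag) ?_⟩
      naturality := fun y y' f => Subtype.ext (hf f.1) }
    { app := fun y => ⟨eqToHom (congrArg Cob.of (hc y.diag).symm), mem (hc y.diag).symm ?_⟩
      naturality := fun y y' f => Subtype.ext ?_ } ?_ h'
  · change u + y.shift = s + (t + y.shift)
    omega
  · change s + (t + y.shift) = u + y.shift
    omega
  · change Cob.stackL e (Cob.stackL c f.1) ≫ eqToHom (congrArg Cob.of (hc y'.diag).symm) =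
      eqToHom (congrArg Cob.of (hc y.diag).symm) ≫ Cob.stackL c' f.1
    rw [← cancel_mono (eqToHom (congrArg Cob.of (hc y'.diag))), Category.assoc, Category.assoc,
      hf f.1]
    simp
  · ext y
    refine Subtype.ext ?_
    exact (eqToHom_trans (congrArg Cob.of (hc y.diag)) (congrArg Cob.of (hc y.diag).symm)).trans
      (eqToHom_refl _ _)

theorem EndsWithTurnback.contractible {k n m : ℕ} {Q : CochainComplex (BN n m) ℤ}
    (hQ : KillsTurnbacksAbove Q) {w : Diag k n} (hw : EndsWithTurnback w) (s : ℤ) :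
    Contractible (rowComplex ⟨s, w⟩ Q) := by
  induction hw with
  | @base k w h =>
    -- The hypothesis on `Q` concerns unshifted turnbacks; stacking with the `s`-shifted identity
    -- diagram supplies the other shifts.
    refine contractible_row_of_stack (.nil k) w w (s := s) (t := 0) (by simp) (fun d => rfl)
      (fun f => ?_) (hQ w h)
    exact (Category.comp_id _).trans ((Cob.stackL_nil _).symm.trans (Category.id_comp _).symm)
  | @cap k i w _ ih =>
    refine contractible_row_of_stack (.cap i (.nil _)) w (.cap i w) (s := 0) (t := s) (by simp)
      (fun d => rfl) (fun f => ?_) ih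
    exact (Category.comp_id _).trans ((Cob.stackL_cap i w f).trans (Category.id_comp _).symm)
  | @cup k i w _ ih =>
    refine contractible_row_of_stack (.cup i (.nil _)) w (.cup i w) (s := 0) (t := s) (by simp)
      (fun d => rfl) (fun f => ?_) ih
    exact (Category.comp_id _).trans ((Cob.stackL_cup i w f).trans (Category.id_comp _).symm)

/-- Diagrams of small through-degree kill complexes which are killed by turnbacks. -/
theorem contractible_rowComplex {k n m : ℕ} {Q : CochainComplex (BN n m) ℤ}
    (hQ : KillsTurnbacksAbove Q) (x : GCob k n) (hx : x.diag.throughDegree < n) :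
    Contractible (rowComplex x Q) := by
  obtain ⟨w, hw, hf⟩ := exists_endsWithTurnback x.diag hx
  exact hf.contractible (fun s => hw.contractible hQ s) x.shift

end Row

/-! ### Rows given by a countable direct sum -/

section CSumRow

universe v u₁ u₂ w₁ w₂
variable {A : Type u₁} {D : Type u₂} {E : Type w₁} [Category.{w₂} A] [Preadditive A]
  [Category.{v} D] [Preadditive D] [Category.{v} E] [Preadditive E]
  (F : A ⥤ D ⥤ E) [F.Additive] [∀ X, (F.obj X).Additive]

/-- The inclusion of the summand `M_i ⊗ Y` of `M ⊗ Y`. -/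
noncomputable def tensorInj (M : CSum A) (i : M.ι) :
    (F.obj (M.X i)).mapMat_ ⋙ CSum.ofMat ⟶ CSum.ofMat ⋙ (CSum.tensor F).obj M where
  app Y := fun b : Y.ι => CSum.entry (CSum.tensorObj F M (CSum.ofMatObj Y)) (i, b) (𝟙 _)
  naturality Y Y' g := by
    refine funext fun b : Y.ι => ?_
    change CSum.push (fun b : Y'.ι => CSum.entry (CSum.tensorObj F M (CSum.ofMatObj Y')) (i, b) (𝟙 _)) _
        (∑ j : Y'.ι, CSum.entry (CSum.ofMatObj ((F.obj (M.X i)).mapMat_.obj Y')) j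
          ((F.obj (M.X i)).map (g b j))) =
      CSum.push (CSum.tensorR F M (CSum.ofMatMap g)) _
        (CSum.entry (CSum.tensorObj F M (CSum.ofMatObj Y)) (i, b) (𝟙 _))
    have e := (CSum.push_entry (N := CSum.tensorObj F M (CSum.ofMatObj Y))
      (CSum.tensorR F M (CSum.ofMatMap g)) _ (i, b) (𝟙 _)).trans (CSum.precomp_id _ _ _)
    refine (map_sum _ _ _).trans (Eq.trans ?_ e.symm)
    refine Eq.trans ?_ (map_sum (CSum.colR F M (CSum.ofMatObj Y') i (Y.X b)) _ _).symm
    refine Finset.sum_congr rfl fun j _ => ?_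
    refine (CSum.push_entry _ _ _ _).trans ((CSum.precomp_entry _ _ _ _).trans ?_)
    exact (congrArg (CSum.entry (CSum.tensorObj F M (CSum.ofMatObj Y')) (i, j))
      (Category.comp_id ((F.obj (M.X i)).map (g b j)))).trans
      (CSum.colR_entry F M (CSum.ofMatObj Y') i (Y.X b) j (g b j)).symm

theorem tensorInj_comp (M : CSum A) (i : M.ι) (Y : Mat_ D) {T : CSum E}
    (f : CSum.tensorObj F M (CSum.ofMatObj Y) ⟶ T) (b : Y.ι) :
    ((tensorInj F M i).app Y ≫ f) b = f (i, b) :=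
  (CSum.push_entry (N := CSum.tensorObj F M (CSum.ofMatObj Y)) f _ (i, b) (𝟙 _)).trans
    (CSum.precomp_id T _ _)

/-- `M ⊗ Q` is contractible if `M_i ⊗ Q` is contractible for all summands `M_i` of `M`. -/
theorem contractible_tensor_row (M : CSum A) (Q : CochainComplex (Mat_ D) ℤ)
    (h : ∀ i, Contractible
      (((F.obj (M.X i)).mapMat_.mapHomologicalComplex (ComplexShape.up ℤ)).obj Q)) :
    Contractible ((((CSum.tensor F).obj M).mapHomologicalComplex (ComplexShape.up ℤ)).obj
      ((CSum.ofMat.mapHomologicalComplex (ComplexShape.up ℤ)).obj Q)) := by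
  let G : M.ι → Mat_ D ⥤ CSum E := fun i => (F.obj (M.X i)).mapMat_ ⋙ CSum.ofMat
  let R : Mat_ D ⥤ CSum E := CSum.ofMat ⋙ (CSum.tensor F).obj M
  let τ : ∀ i, G i ⟶ R := fun i => tensorInj F M i
  have h' : ∀ i, ∃ s : ∀ a b : ℤ, (G i).obj (Q.X a) ⟶ (G i).obj (Q.X b), ∀ a b c : ℤ,
      a + 1 = b → c + 1 = a → (G i).map (Q.d a b) ≫ s b a + s a c ≫ (G i).map (Q.d c a) = 𝟙 _ :=
    fun i => ((h i).map CSum.ofMat).exists_hom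
  choose s hs using h'
  -- A matrix with finite columns is an arbitrary choice of columns, so infinitely many homotopies
  -- combine without a finiteness condition.
  let H : ∀ a b : ℤ, R.obj (Q.X a) ⟶ R.obj (Q.X b) := fun a b p =>
    (s p.1 a b ≫ (τ p.1).app (Q.X b)) p.2
  have hH : ∀ i a b, (τ i).app (Q.X a) ≫ H a b = s i a b ≫ (τ i).app (Q.X b) :=
    fun i a b => funext fun y => tensorInj_comp F M i (Q.X a) (H a b) y
  have ext : ∀ {a b : ℤ} (f g : R.obj (Q.X a) ⟶ R.obj (Q.X b)),
      (∀ i, (τ i).app (Q.X a) ≫ f = (τ i).app (Q.X a) ≫ g) → f = g := by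
    intro a b f g hfg
    funext p
    have := congrFun (hfg p.1) p.2
    exact (tensorInj_comp F M p.1 (Q.X a) f p.2).symm.trans
      (this.trans (tensorInj_comp F M p.1 (Q.X a) g p.2))
  refine contractible_of_hom H fun a b c hb hc => ?_
  change R.map (Q.d a b) ≫ H b a + H a c ≫ R.map (Q.d c a) = 𝟙 (R.obj (Q.X a))
  refine ext _ _ fun i => ?_
  rw [Preadditive.comp_add, ← Category.assoc, ← Category.assoc, ← (τ i).naturality, Category.assoc,
    hH, hH, Category.assoc, ← (τ i).naturality, ← Category.assoc, ← Category.assoc,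
    ← Preadditive.add_comp, hs i a b c hb hc, Category.id_comp, Category.comp_id]

end CSumRow

/-- The through-degree bounds the through-degrees of all summands. -/
theorem diag_throughDegree_lt {k n l : ℕ} {N : CochainComplex (BNSum k n) ℤ}
    (h : throughDegree N < ((l : ℕ∞) : WithBot ℕ∞)) (i : ℤ) (x : (N.X i).ι) :
    ((N.X i).X x).diag.throughDegree < l := by
  have h₁ : ((((N.X i).X x).diag.throughDegree : ℕ∞) : WithBot ℕ∞) ≤ throughDegree N :=
    le_iSup₂_of_le (f := fun (i : ℤ) (x : (N.X i).ι) =>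
      ((((N.X i).X x).diag.throughDegree : ℕ∞) : WithBot ℕ∞)) i x le_rfl
  exact_mod_cast h₁.trans_lt h

/-- The two halves meet here: the through-degree makes each row contractible, and boundedness passes
to the total complex. -/
theorem contractible_tensorComplex {k n m : ℕ} {Q : CochainComplex (BN n m) ℤ}
    (hQ : KillsTurnbacksAbove Q) (N : CochainComplex (BNSum k n) ℤ)
    (hN : throughDegree N < ((n : ℕ∞) : WithBot ℕ∞)) (hb : BoundedBelow Q ∨ BoundedAbove N) :
    Contractible (tensorComplex N (toBNSum Q)) := by
  refine contractible_mapBifunctor _ N (toBNSum Q) (fun i => ?_) (hb.imp ?_ id)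
  · exact contractible_tensor_row _ _ _ fun x =>
      contractible_rowComplex hQ _ (diag_throughDegree_lt hN i x)
  · rintro ⟨b, hb⟩
    exact ⟨b, fun i hi => CSum.ofMat.map_isZero (hb i hi)⟩

end BarNatan

theorem mainTheorem11 (k n m : ℕ) (Q : CochainComplex (BarNatan.BN n m) ℤ)
    (hQ : BarNatan.KillsTurnbacksAbove Q) :
    (∀ N : CochainComplex (BarNatan.BN k n) ℤ,
      BarNatan.throughDegree (BarNatan.toBNSum N) < ((n : ℕ∞) : WithBot ℕ∞) →
      (BarNatan.BoundedBelow Q ∨ BarNatan.BoundedAbove N) →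
      BarNatan.Contractible
        (BarNatan.tensorComplex (BarNatan.toBNSum N) (BarNatan.toBNSum Q))) ∧
    (∀ N : CochainComplex (BarNatan.BNSum k n) ℤ,
      BarNatan.throughDegree N < ((n : ℕ∞) : WithBot ℕ∞) →
      (BarNatan.BoundedBelow Q ∨ BarNatan.BoundedAbove N) →
      BarNatan.Contractible (BarNatan.tensorComplex N (BarNatan.toBNSum Q))) := by
  -- The finite case is the countable case for `toBNSum N`; the inclusion is additive and so
  -- preserves zero objects and boundedness.
  refine ⟨fun N hN hb => BarNatan.contractible_tensorComplex hQ _ hN (hb.imp id ?_),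
    fun N hN hb => BarNatan.contractible_tensorComplex hQ N hN hb⟩
  rintro ⟨b, hb⟩
  exact ⟨b, fun i hi => BarNatan.CSum.ofMat.map_isZero (hb i hi)⟩
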